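/- Let $S$ be a complete separable metric space with its Borel $\sigma$-algebra, and let $X=(X(t):t\ge 0)$ be a (jointly measurable) time-homogeneous $S$-valued Markov process with measurable transition function; write $P_x,\mathbb{E}_x$ for probability and expectation given $X(0)=x$. Suppose that $X$ is $v$-geometrically ergodic: there are a measurable $v:S\to[1,\infty)$, a probability $\pi$ on $S$, $d<\infty$ and $\alpha>0$ such that \[ \sup_{|h|\le v}\Big|\mathbb{E}_x h(X(t))-\int_S h\,d\pi\Big|\le d\,v(x)e^{-\alpha t}\qquad (t\ge 0,\ x\in S), \] the supremum being over measurable $h$ (all expectations being assumed to exist, i.e. $v$ is integrable under $\pi$ and under every transition law). Let $f:S\to[0,\infty)$ be bounded and measurable with $\lambda^*:=\mathbb{E}f(X(\infty))=\int_S f\,d\pi>0$, where $X(\infty)$ has law $\pi$. For $0<\epsilon\le 1$ let $N_\epsilon$ be a doubly stochastic Poisson process with stochastic intensity $\lambda_\epsilon(t)=f(X(t/\epsilon))$, and let $N_0$ be a Poisson process with constant rate $\lambda^*$. Put \[ f_c(y)=f(y)-\lambda^*,\qquad g(y)=\int_0^\infty \mathbb{E}_y f_c(X(t))\,dt,\qquad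 \sigma^2=2\,\mathbb{E}\, f_c(X(\infty))\,g(X(\infty)). \] Then the integral defining $g(y)$ converges absolutely for every $y\in S$, the expectation defining $\sigma^2$ exists, and for every $x\in S$, $t>0$ and $k\in\{0,1,2,\dots\}$, \[ P_x(N_\epsilon(t)=k)=P(N_0(t)=k)+\epsilon\,P(N_0(t)=k)\left[\left(\frac{k}{\lambda^*t}-1\right)g(x)+\frac12\left(1-\frac{2k}{\lambda^*t}+\frac{k(k-1)}{(\lambda^*t)^2}\right)\sigma^2t\right]+o(\epsilon) \] as $\epsilon\downarrow 0$. -/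

import Mathlib

open MeasureTheory ProbabilityTheory Filter Topology
open scoped NNReal ENNReal

noncomputable section

/-- A time-homogeneous (measurable) transition function on `S`: `κ (t, x)` is the law at time `t`
of the process started at `x`. Joint measurability in `(t, x)` is part of `κ` being a kernel. -/
structure IsTransitionFunction {S : Type*} [MeasurableSpace S] (κ : Kernel (ℝ≥0 × S) S) :
    Prop where
  isMarkovKernel : IsMarkovKernel κ
  zero : ∀ x, κ (0, x) = Measure.dirac x
  chapman_kolmogorov : ∀ (s t : ℝ≥0) (x : S) (A : Set S), MeasurableSet A →
    κ (s + t, x) A = ∫⁻ y, κ (t, y) A ∂(κ (s, x))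

/-- Under `P`, the `S`-valued process `X` is a (jointly measurable) time-homogeneous Markov
process, with respect to its own history, with transition function `κ` and started at `x`. -/
structure IsMarkovProcessFrom {S Ω : Type*} [MeasurableSpace S] [MeasurableSpace Ω]
    (κ : Kernel (ℝ≥0 × S) S) (x : S) (X : ℝ≥0 → Ω → S) (P : Measure Ω) : Prop where
  transition : IsTransitionFunction κ
  measurable : Measurable (Function.uncurry X)
  initial : ∀ᵐ ω ∂P, X 0 ω = x
  markov : ∀ (s t : ℝ≥0) (A : Set S), MeasurableSet A →
    P⟦X (s + t) ⁻¹' A | ⨆ u : Set.Iic s, MeasurableSpace.comap (X u) inferInstance⟧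
      =ᵐ[P] fun ω => (κ (t, X s ω)).real A

/-- `v`-geometric ergodicity with limit law `π`: there are `d < ∞` and `α > 0` such that
`sup_{|h| ≤ v} |E_x h(X(t)) - ∫ h dπ| ≤ d v(x) e^{-α t}` for all `t ≥ 0` and all `x`.
The integrability fields say that the expectations in this supremum exist. -/
structure IsGeometricallyErgodic {S : Type*} [MeasurableSpace S]
    (κ : Kernel (ℝ≥0 × S) S) (v : S → ℝ) (π : Measure S) : Prop where
  isProbabilityMeasure : IsProbabilityMeasure π
  measurable : Measurable v
  one_le : ∀ x, 1 ≤ v x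
  integrable_limit : Integrable v π
  integrable : ∀ (t : ℝ≥0) (x : S), Integrable v (κ (t, x))
  bound : ∃ d α : ℝ, 0 < α ∧ ∀ (t : ℝ≥0) (x : S) (h : S → ℝ), Measurable h →
    (∀ y, |h y| ≤ v y) →
      |∫ y, h y ∂(κ (t, x)) - ∫ y, h y ∂π| ≤ d * v x * Real.exp (-α * t)

/-- A counting process: almost surely, it starts at `0` and its paths are nondecreasing and
right-continuous. -/
structure IsCountingProcess {Ω : Type*} [MeasurableSpace Ω]
    (N : ℝ≥0 → Ω → ℕ) (P : Measure Ω) : Prop where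
  measurable : ∀ t, Measurable (N t)
  zero : ∀ᵐ ω ∂P, N 0 ω = 0
  mono : ∀ᵐ ω ∂P, Monotone fun t => N t ω
  right_continuous : ∀ᵐ ω ∂P, ∀ t, ContinuousWithinAt (fun s => N s ω) (Set.Ici t) t

/-- A Poisson process with constant rate `r`. (The subtraction of natural numbers is harmless,
the paths being nondecreasing.) -/
structure IsPoissonProcess {Ω : Type*} [MeasurableSpace Ω]
    (r : ℝ≥0) (N : ℝ≥0 → Ω → ℕ) (P : Measure Ω) : Prop where
  counting : IsCountingProcess N P
  indep : HasIndepIncrements N P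
  law : ∀ s t : ℝ≥0, s ≤ t → P.map (fun ω => N t ω - N s ω) = poissonMeasure (r * (t - s))

/-- The integrated intensity `∫_s^t lam(u) du` along the path `ω`. -/
def integratedIntensity {Ω : Type*} (lam : ℝ≥0 → Ω → ℝ) (s t : ℝ≥0) (ω : Ω) : ℝ :=
  ∫ u in (s : ℝ)..(t : ℝ), lam u.toNNReal ω

/-- A doubly stochastic Poisson (Cox) process with stochastic intensity `lam`: conditionally on
the whole intensity process, the increments over successive intervals are independent, and the
increment over `(s, t]` is Poisson with mean `∫_s^t lam(u) du`. -/
structure IsDoublyStochasticPoisson {Ω : Type*} [MeasurableSpace Ω]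
    (lam : ℝ≥0 → Ω → ℝ) (N : ℝ≥0 → Ω → ℕ) (P : Measure Ω) : Prop where
  counting : IsCountingProcess N P
  intensity_measurable : Measurable (Function.uncurry lam)
  intensity_nonneg : ∀ t ω, 0 ≤ lam t ω
  intensity_locallyIntegrable : ∀ᵐ ω ∂P, ∀ t : ℝ≥0,
    IntervalIntegrable (fun u : ℝ => lam u.toNNReal ω) volume 0 t
  conditional_law : ∀ (n : ℕ) (τ : Fin (n + 1) → ℝ≥0), Monotone τ → ∀ k : Fin n → ℕ,
    P⟦{ω | ∀ i : Fin n, N (τ i.succ) ω = N (τ i.castSucc) ω + k i} |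
        ⨆ t, MeasurableSpace.comap (lam t) inferInstance⟧
      =ᵐ[P] fun ω => ∏ i : Fin n,
        (Real.exp (-integratedIntensity lam (τ i.castSucc) (τ i.succ) ω) *
          integratedIntensity lam (τ i.castSucc) (τ i.succ) ω ^ k i / (Nat.factorial (k i) : ℝ))

/-- `f_c(y) = f(y) - E f(X(∞))`, where `X(∞)` has law `π`. -/
def centered {S : Type*} [MeasurableSpace S] (π : Measure S) (f : S → ℝ) (y : S) : ℝ :=
  f y - ∫ z, f z ∂π

/-- `E_x f_c(X(t))`. -/
def meanCentered {S : Type*} [MeasurableSpace S] (κ : Kernel (ℝ≥0 × S) S) (π : Measure S)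
    (f : S → ℝ) (x : S) (t : ℝ≥0) : ℝ :=
  ∫ y, centered π f y ∂(κ (t, x))

/-- `g(x) = ∫_0^∞ E_x f_c(X(t)) dt`. -/
def potential {S : Type*} [MeasurableSpace S] (κ : Kernel (ℝ≥0 × S) S) (π : Measure S)
    (f : S → ℝ) (x : S) : ℝ :=
  ∫ t in Set.Ioi (0 : ℝ), meanCentered κ π f x t.toNNReal

/-- `σ² = 2 E f_c(X(∞)) g(X(∞))`. -/
def asymptoticVariance {S : Type*} [MeasurableSpace S] (κ : Kernel (ℝ≥0 × S) S) (π : Measure S)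
    (f : S → ℝ) : ℝ :=
  2 * ∫ y, centered π f y * potential κ π f y ∂π

end

noncomputable section

/-! Conditioning on the intensity gives P(N_ε(t) = k) = E p_k(Λ), where p_k is the Poisson weight as
a function of its mean and Λ = λ*t + εZ_T, with Z_T = ∫_0^T f_c(X(u)) du and T = t/ε. A Taylor
expansion of p_k at λ*t reduces the claim to moments of Z_T: E Z_T → g(x), E Z_T² = σ²T + O(1), E
Z_T³ = O(T), E Z_T⁴ = O(T²). Since εT = t, the first two give the two terms of order ε, and every
other contribution is o(ε).

By the Markov property, E Z_T^n = n! (Dⁿ1)(T, x) for D = `duhamel κ f_c`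
(`integral_occupation_pow`). Geometric ergodicity makes D1 bounded by a multiple of v and
exponentially close to g. In general each application of D costs a factor T, but because f_c has
mean zero under π, two applications together cost only one factor T (`abs_duhamel_duhamel_le`). This
yields the third and fourth moments from D²(D1) and D²(D²1). The sharp form of the second moment is
`abs_duhamel_duhamel_one_sub_le`. -/

/-! ### Measurability of parameter integrals with respect to a sub-σ-algebra. -/

/-- The process is jointly measurable but not assumed progressively measurable, so Fubini does not
give measurability of path integrals with respect to the past. Instead, the L² distance between the
integral Z and its conditional expectation on `m` is shown to vanish. -/
theorem aestronglyMeasurable_integral_of_forall_section {Ω T : Type*} {m m₀ : MeasurableSpace Ω}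
    {mT : MeasurableSpace T} {P : Measure Ω} [IsProbabilityMeasure P] {μ : Measure T}
    [IsFiniteMeasure μ] (hm : m ≤ m₀) {Y : T → Ω → ℝ}
    (hY : Measurable (Function.uncurry Y)) {C : ℝ} (hC : ∀ u ω, |Y u ω| ≤ C)
    (hYm : ∀ᵐ u ∂μ, AEStronglyMeasurable[m] (Y u) P) :
    AEStronglyMeasurable[m] (fun ω => ∫ u, Y u ω ∂μ) P := by
  set Z : Ω → ℝ := fun ω => ∫ u, Y u ω ∂μ with hZ
  have hYu : ∀ u, Measurable (Y u) := fun u => hY.of_uncurry_left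
  have hZsm : StronglyMeasurable Z :=
    hY.stronglyMeasurable.integral_prod_left
  have hZb : ∀ ω, |Z ω| ≤ C * μ.real Set.univ := fun ω =>
    norm_integral_le_of_norm_le_const (μ := μ) (f := fun u => Y u ω) (Eventually.of_forall fun u => hC u ω)
  have hZint : Integrable Z P :=
    Integrable.of_bound hZsm.aestronglyMeasurable _ (Eventually.of_forall fun ω => by
      simpa using hZb ω)
  -- Fubini reduces this to a single section `Y u`, which may be pulled out of the conditional
  -- expectation.
  have key : ∀ V : Ω → ℝ, StronglyMeasurable V → (∃ B, ∀ᵐ ω ∂P, |V ω| ≤ B) →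
      ∫ ω, Z ω * V ω ∂P = ∫ ω, Z ω * (P[V | m]) ω ∂P := by
    have fub : ∀ V : Ω → ℝ, StronglyMeasurable V → Integrable V P →
        ∫ ω, Z ω * V ω ∂P = ∫ u, ∫ ω, Y u ω * V ω ∂P ∂μ := by
      intro V hV hVi
      rw [integral_integral_swap]
      · simp_rw [integral_mul_const]; rfl
      · refine Integrable.bdd_mul (c := C) (hVi.comp_snd μ) hY.aestronglyMeasurable
          (Eventually.of_forall fun p => by simpa [Function.uncurry] using hC p.1 p.2)
    intro V hV ⟨B, hB⟩
    have hVi : Integrable V P := Integrable.of_bound hV.aestronglyMeasurable B hB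
    rw [fub V hV hVi, fub _ (stronglyMeasurable_condExp.mono hm) integrable_condExp]
    refine integral_congr_ae ?_
    filter_upwards [hYm] with u hu
    have hYi : Integrable (Y u * V) P := by
      refine hVi.bdd_mul (c := C) (hYu u).aestronglyMeasurable
        (Eventually.of_forall fun ω => by simpa using hC u ω)
    rw [← integral_condExp hm]
    refine integral_congr_ae ?_
    filter_upwards [condExp_mul_of_aestronglyMeasurable_left hu hYi hVi] with ω hω
    exact hω
  have hcb : ∀ᵐ ω ∂P, |(P[Z | m]) ω| ≤ C * μ.real Set.univ :=
    ae_bdd_abs_condExp_of_ae_bdd_abs (Eventually.of_forall hZb)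
  have hcm : StronglyMeasurable[m] (P[Z | m]) := stronglyMeasurable_condExp
  have hci : Integrable (P[Z | m]) P := integrable_condExp
  have e1 := key (fun ω => Z ω - (P[Z | m]) ω) (hZsm.sub (hcm.mono hm))
    ⟨2 * (C * μ.real Set.univ), by
      filter_upwards [hcb] with ω hω
      have := abs_sub (Z ω) ((P[Z | m]) ω)
      linarith [hZb ω]⟩
  have e2 : P[fun ω => Z ω - (P[Z | m]) ω | m] =ᵐ[P] 0 := by
    have h1 : P[Z - P[Z | m] | m] =ᵐ[P] P[Z | m] - P[P[Z | m] | m] := condExp_sub hZint hci m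
    have h2 : P[P[Z | m] | m] = P[Z | m] := condExp_of_stronglyMeasurable hm hcm hci
    rw [h2, sub_self] at h1
    exact h1
  have hdi : Integrable (fun ω => Z ω - (P[Z | m]) ω) P := hZint.sub hci
  have hsm : StronglyMeasurable (fun ω => Z ω - (P[Z | m]) ω) := hZsm.sub (hcm.mono hm)
  have i1 : Integrable (fun ω => Z ω * (Z ω - (P[Z | m]) ω)) P :=
    hdi.bdd_mul hZsm.aestronglyMeasurable (Eventually.of_forall fun ω => hZb ω)
  have i2 : Integrable (fun ω => (P[Z | m]) ω * (Z ω - (P[Z | m]) ω)) P :=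
    hdi.bdd_mul (hcm.mono hm).aestronglyMeasurable hcb
  have e3 : ∫ ω, (P[Z | m]) ω * (Z ω - (P[Z | m]) ω) ∂P = 0 := by
    have h3 : P[(P[Z | m]) * (fun ω => Z ω - (P[Z | m]) ω) | m] =ᵐ[P]
        P[Z | m] * P[(fun ω => Z ω - (P[Z | m]) ω) | m] :=
      condExp_mul_of_stronglyMeasurable_left hcm i2 hdi
    have : ∫ ω, (P[(P[Z | m]) * (fun ω => Z ω - (P[Z | m]) ω) | m]) ω ∂P = 0 := by
      rw [integral_congr_ae (g := 0)]
      · simp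
      · filter_upwards [h3, e2] with ω h h'
        rw [h, Pi.mul_apply, h']; simp
    rwa [integral_condExp hm] at this
  -- With W = Z − E[Z|m], both E[ZW] and E[E[Z|m]W] vanish since E[W|m] = 0, so E[W²] = 0.
  have e4 : ∫ ω, (Z ω - (P[Z | m]) ω) * (Z ω - (P[Z | m]) ω) ∂P = 0 := by
    simp_rw [sub_mul]
    rw [integral_sub i1 i2, e1, e3, sub_zero]
    rw [integral_congr_ae (g := 0)]
    · simp
    · filter_upwards [e2] with ω h'
      rw [h']; simp
  rw [integral_eq_zero_iff_of_nonneg (fun ω => mul_self_nonneg _)] at e4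
  · refine ⟨P[Z | m], hcm, ?_⟩
    filter_upwards [e4] with ω hω
    exact sub_eq_zero.1 (mul_self_eq_zero.1 hω)
  · simp_rw [sub_mul]; exact i1.sub i2

/-! ### The Markov property for bounded functions. -/

namespace IsMarkovProcessFrom

/-- The σ-algebra of the history of `X` up to time `s`. -/
abbrev history {S Ω : Type*} [MeasurableSpace S] (X : ℝ≥0 → Ω → S) (s : ℝ≥0) : MeasurableSpace Ω :=
  ⨆ u : Set.Iic s, MeasurableSpace.comap (X u) inferInstance

theorem measurable_history {S Ω : Type*} [MeasurableSpace S] {X : ℝ≥0 → Ω → S} {r s : ℝ≥0} (h : r ≤ s) : Measurable[history X s] (X r) := by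
  refine Measurable.mono (comap_measurable (X r)) ?_ le_rfl
  exact le_iSup (fun u : Set.Iic s => MeasurableSpace.comap (X u) inferInstance) ⟨r, h⟩

variable {S Ω : Type*} [MeasurableSpace S] [MeasurableSpace Ω] {κ : Kernel (ℝ≥0 × S) S} {x : S}
  {X : ℝ≥0 → Ω → S} {P : Measure Ω}

theorem measurable_apply (hX : IsMarkovProcessFrom κ x X P) (t : ℝ≥0) : Measurable (X t) :=
  hX.measurable.of_uncurry_left

theorem history_le (hX : IsMarkovProcessFrom κ x X P) (s : ℝ≥0) :
    history X s ≤ ‹MeasurableSpace Ω› :=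
  iSup_le fun u => (hX.measurable_apply u).comap_le

/-- Integrating the Markov property for indicators over a past event gives an identity of measures;
integrating functions against both sides then replaces an approximation by simple functions. -/
theorem map_restrict_eq_comp [IsProbabilityMeasure P] (hX : IsMarkovProcessFrom κ x X P)
    (s t : ℝ≥0) {D : Set Ω} (hD : MeasurableSet[history X s] D) :
    (P.restrict D).map (X (s + t)) =
      (κ.comap (fun y => (t, y)) measurable_prodMk_left) ∘ₘ ((P.restrict D).map (X s)) := by
  have := hX.transition.isMarkovKernel
  have hXm := hX.measurable_apply
  have hm := hX.history_le s
  ext A hA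
  rw [Measure.map_apply (hXm _) hA, Measure.bind_apply hA (Kernel.aemeasurable _),
    lintegral_map (Kernel.measurable_coe _ hA) (hXm s)]
  have hi : Integrable ((X (s + t) ⁻¹' A).indicator fun _ => (1 : ℝ)) P :=
    (integrable_const _).indicator (hXm _ hA)
  have h1 := setIntegral_condExp hm hi hD
  rw [setIntegral_congr_ae (hm _ hD) ((hX.markov s t A hA).mono fun ω hω _ => hω),
    integral_indicator_const _ (hXm _ hA), smul_eq_mul, mul_one] at h1
  have h2 : ∫⁻ ω in D, κ (t, X s ω) A ∂P
      = ENNReal.ofReal (∫ ω in D, (κ (t, X s ω)).real A ∂P) := by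
    rw [ofReal_integral_eq_lintegral_ofReal]
    · simp [measureReal_def]
    · refine Integrable.of_bound (C := 1) ?_ ?_
      · exact ((Kernel.measurable_coe κ hA).comp
          (measurable_prodMk_left.comp (hXm s))).ennreal_toReal.aestronglyMeasurable
      · exact Eventually.of_forall fun ω =>
        (Real.norm_of_nonneg measureReal_nonneg).trans_le measureReal_le_one
    · exact Eventually.of_forall fun ω => measureReal_nonneg
  simp only [Kernel.comap_apply]
  rw [h2, h1, measureReal_def, ENNReal.ofReal_toReal (measure_ne_top _ _)]

theorem condExp_comp_add [IsProbabilityMeasure P] (hX : IsMarkovProcessFrom κ x X P)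
    (s t : ℝ≥0) {h : S → ℝ} (hh : Measurable h) {B : ℝ} (hB : ∀ y, |h y| ≤ B) :
    P[fun ω => h (X (s + t) ω) | history X s] =ᵐ[P] fun ω => ∫ y, h y ∂(κ (t, X s ω)) := by
  have := hX.transition.isMarkovKernel
  have hXm := hX.measurable_apply
  have hm := hX.history_le s
  have hsm : StronglyMeasurable fun y => ∫ z, h z ∂(κ (t, y)) :=
    StronglyMeasurable.integral_kernel_prod_right'' (η := κ) (a := t)
      (f := fun p => h p.2) (hh.comp measurable_snd).stronglyMeasurable
  have hb : ∀ y, |∫ z, h z ∂(κ (t, y))| ≤ B := fun y => by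
    simpa using norm_integral_le_of_norm_le_const (μ := κ (t, y)) (f := h)
      (Eventually.of_forall fun u => hB u)
  symm
  refine ae_eq_condExp_of_forall_setIntegral_eq hm ?_ ?_ ?_ ?_
  · exact Integrable.of_bound (hh.comp (hXm _)).aestronglyMeasurable B
      (Eventually.of_forall fun ω => hB _)
  · intro D _ _
    exact (Integrable.of_bound (hsm.measurable.comp (hXm s)).aestronglyMeasurable B
      (Eventually.of_forall fun ω => hb _)).integrableOn
  · intro D hD _
    have e1 : ∫ y, h y ∂((P.restrict D).map (X (s + t))) = ∫ ω in D, h (X (s + t) ω) ∂P :=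
      integral_map (hXm _).aemeasurable hh.aestronglyMeasurable
    rw [← e1, hX.map_restrict_eq_comp s t hD, Measure.comp_eq_comp_const_apply,
      Kernel.integral_comp]
    · simp only [Kernel.const_apply, Kernel.comap_apply]
      rw [integral_map (hXm _).aemeasurable hsm.aestronglyMeasurable]
    · exact Integrable.of_bound hh.aestronglyMeasurable B (Eventually.of_forall hB)
  · exact (hsm.comp_measurable (measurable_history le_rfl)).aestronglyMeasurable

/-- The factor `Y` is only almost everywhere equal to a function of the past, which is all that is
known of occupation integrals. -/
theorem integral_mul_comp_add [IsProbabilityMeasure P] (hX : IsMarkovProcessFrom κ x X P)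
    (s t : ℝ≥0) {h : S → ℝ} (hh : Measurable h) {B : ℝ} (hB : ∀ y, |h y| ≤ B)
    {Y : Ω → ℝ} (hY : AEStronglyMeasurable[history X s] Y P) {C : ℝ} (hC : ∀ ω, |Y ω| ≤ C) :
    ∫ ω, Y ω * h (X (s + t) ω) ∂P = ∫ ω, Y ω * ∫ y, h y ∂(κ (t, X s ω)) ∂P := by
  have hm := hX.history_le s
  have hhi : Integrable (fun ω => h (X (s + t) ω)) P :=
    Integrable.of_bound (hh.comp (hX.measurable_apply _)).aestronglyMeasurable B
      (Eventually.of_forall fun ω => hB _)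
  have hYi : Integrable (Y * fun ω => h (X (s + t) ω)) P :=
    hhi.bdd_mul (hY.mono hm) (Eventually.of_forall fun ω => hC ω)
  have e := condExp_mul_of_aestronglyMeasurable_left hY hYi hhi
  have e1 : ∫ ω, Y ω * h (X (s + t) ω) ∂P =
      ∫ ω, (P[Y * fun ω => h (X (s + t) ω) | history X s]) ω ∂P := (integral_condExp hm).symm
  rw [e1]
  refine integral_congr_ae ?_
  filter_upwards [e, hX.condExp_comp_add s t hh hB] with ω h1 h2
  rw [h1, Pi.mul_apply, h2]

theorem integral_comp [IsProbabilityMeasure P] (hX : IsMarkovProcessFrom κ x X P)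
    (t : ℝ≥0) {h : S → ℝ} (hh : Measurable h) {B : ℝ} (hB : ∀ y, |h y| ≤ B) :
    ∫ ω, h (X t ω) ∂P = ∫ y, h y ∂(κ (t, x)) := by
  have e := hX.integral_mul_comp_add 0 t hh hB (Y := fun _ => 1) aestronglyMeasurable_const
    (C := 1) (by simp)
  simp only [one_mul, zero_add] at e
  rw [e, integral_congr_ae (g := fun _ => ∫ y, h y ∂(κ (t, x)))]
  · simp
  · filter_upwards [hX.initial] with ω hω
    rw [hω]

end IsMarkovProcessFrom

/-! ### Time integrals, the Duhamel operator and occupation integrals. -/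

theorem measurable_setIntegral_Ioc {α : Type*} [MeasurableSpace α] {F : α → ℝ → ℝ}
    (hF : Measurable (Function.uncurry F)) {R : α → ℝ} (hR : Measurable R) :
    Measurable fun a => ∫ u in Set.Ioc 0 (R a), F a u := by
  have hs : MeasurableSet {p : α × ℝ | 0 < p.2 ∧ p.2 ≤ R p.1} :=
    (measurableSet_lt measurable_const measurable_snd).inter
      (measurableSet_le measurable_snd (hR.comp measurable_fst))
  have h : (fun a => ∫ u in Set.Ioc 0 (R a), F a u) =
      fun a => ∫ u, {p : α × ℝ | 0 < p.2 ∧ p.2 ≤ R p.1}.indicator (Function.uncurry F) (a, u) := by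
    funext a
    rw [← integral_indicator measurableSet_Ioc]
    rfl
  rw [h]
  exact ((hF.indicator hs).stronglyMeasurable.integral_prod_right').measurable

theorem abs_setIntegral_Ioc_le {a : ℝ → ℝ} {C R : ℝ} (hR : 0 ≤ R)
    (h : ∀ u ∈ Set.Ioc 0 R, |a u| ≤ C) : |∫ u in Set.Ioc 0 R, a u| ≤ C * R := by
  have := norm_setIntegral_le_of_norm_le_const (f := a) (μ := volume) (s := Set.Ioc 0 R) (C := C)
    (by simp) h
  simpa [measureReal_def, hR] using this

/-- The integrand is merely measurable, so the primitive is differentiable only almost everywhere;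
its powers are absolutely continuous, and the fundamental theorem of calculus for such functions
applies. -/
theorem setIntegral_Ioc_pow {a : ℝ → ℝ} (ha : Measurable a) {C : ℝ} (hC : ∀ u, |a u| ≤ C)
    (n : ℕ) {s : ℝ} (hs : 0 ≤ s) :
    (∫ u in Set.Ioc 0 s, a u) ^ (n + 1) =
      (n + 1) * ∫ r in Set.Ioc 0 s, (∫ u in Set.Ioc 0 r, a u) ^ n * a r := by
  have hai : ∀ p q : ℝ, IntervalIntegrable a volume p q := fun p q => by
    rw [intervalIntegrable_iff]
    exact Measure.integrableOn_of_bounded (by simp) ha.aestronglyMeasurable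
      (Eventually.of_forall hC)
  set A : ℝ → ℝ := fun s => ∫ u in (0 : ℝ)..s, a u with hA
  have hAC : ∀ m : ℕ, AbsolutelyContinuousOnInterval (fun x => A x ^ (m + 1)) 0 s := by
    intro m
    induction m with
    | zero => simpa using (hai 0 s).absolutelyContinuousOnInterval_intervalIntegral (by simp)
    | succ m ih =>
      have := ih.fun_mul ((hai 0 s).absolutelyContinuousOnInterval_intervalIntegral
        (c := 0) (by simp))
      simpa [pow_succ] using this
  have h1 := (hAC n).integral_deriv_eq_sub
  have h2 : ∫ x in (0 : ℝ)..s, deriv (fun x => A x ^ (n + 1)) x =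
      ∫ x in (0 : ℝ)..s, (n + 1) * (A x ^ n * a x) := by
    refine intervalIntegral.integral_congr_ae ?_
    filter_upwards [(hai 0 s).ae_hasDerivAt_integral] with x hx hxs
    have := ((hx (Set.uIoc_subset_uIcc hxs) 0 (by simp)).pow (n + 1)).deriv
    simp only [Nat.add_sub_cancel] at this
    rw [show (fun x => A x ^ (n + 1)) = (fun x => ∫ u in (0 : ℝ)..x, a u) ^ (n + 1) from rfl, this]
    push_cast
    ring
  rw [h2, intervalIntegral.integral_const_mul] at h1
  have h0 : A 0 = 0 := by simp [hA]
  rw [h0, zero_pow (Nat.succ_ne_zero n), sub_zero] at h1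
  rw [← intervalIntegral.integral_of_le hs]
  rw [intervalIntegral.integral_of_le hs] at h1
  rw [show (∫ u in (0 : ℝ)..s, a u) = A s from rfl, ← h1]
  congr 1
  refine setIntegral_congr_fun measurableSet_Ioc fun r hr => ?_
  simp only [hA]
  rw [intervalIntegral.integral_of_le hr.1.le]

/-- The operator `H ↦ ((R, y) ↦ ∫_0^R E_y [c(X(u)) H(R - u, X(u))] du)`. -/
def duhamel {S : Type*} [MeasurableSpace S] (κ : Kernel (ℝ≥0 × S) S) (c : S → ℝ)
    (H : ℝ → S → ℝ) (R : ℝ) (y : S) : ℝ :=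
  ∫ u in Set.Ioc 0 R, ∫ z, c z * H (R - u) z ∂(κ (u.toNNReal, y))

theorem measurable_kernel_integral {S α : Type*} [MeasurableSpace S] [MeasurableSpace α]
    {κ : Kernel (ℝ≥0 × S) S} [IsMarkovKernel κ] {F : α → S → ℝ}
    (hF : Measurable (Function.uncurry F)) {t : α → ℝ≥0} (ht : Measurable t) {y : α → S}
    (hy : Measurable y) : Measurable fun a => ∫ z, F a z ∂(κ (t a, y a)) := by
  have := StronglyMeasurable.integral_kernel_prod_right'
    (κ := κ.comap (fun a => (t a, y a)) (ht.prodMk hy)) hF.stronglyMeasurable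
  exact this.measurable

theorem measurable_duhamel {S : Type*} [MeasurableSpace S] {κ : Kernel (ℝ≥0 × S) S}
    [IsMarkovKernel κ] {c : S → ℝ} (hc : Measurable c) {H : ℝ → S → ℝ}
    (hH : Measurable (Function.uncurry H)) :
    Measurable (Function.uncurry (duhamel κ c H)) := by
  refine measurable_setIntegral_Ioc (α := ℝ × S)
    (F := fun p u => ∫ z, c z * H (p.1 - u) z ∂(κ (u.toNNReal, p.2))) ?_ measurable_fst
  refine measurable_kernel_integral (α := (ℝ × S) × ℝ)
    (F := fun q z => c z * H (q.1.1 - q.2) z) ?_ (by fun_prop) (by fun_prop)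
  refine (hc.comp measurable_snd).mul ?_
  exact hH.comp (f := fun q : ((ℝ × S) × ℝ) × S => (q.1.1.1 - q.1.2, q.2)) (by fun_prop)

theorem abs_kernel_integral_le {S : Type*} [MeasurableSpace S] {μ : Measure S}
    [IsProbabilityMeasure μ] {h : S → ℝ} {B : ℝ} (hB : ∀ y, |h y| ≤ B) :
    |∫ y, h y ∂μ| ≤ B := by
  simpa using norm_integral_le_of_norm_le_const (μ := μ) (f := h) (Eventually.of_forall hB)

theorem abs_duhamel_le {S : Type*} [MeasurableSpace S] {κ : Kernel (ℝ≥0 × S) S}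
    [IsMarkovKernel κ] {c : S → ℝ} {C : ℝ} (hC : ∀ y, |c y| ≤ C) {H : ℝ → S → ℝ} {B T : ℝ}
    (hB : ∀ R, 0 ≤ R → R ≤ T → ∀ y, |H R y| ≤ B) {R : ℝ} (hR : 0 ≤ R) (hRT : R ≤ T) (y : S) :
    |duhamel κ c H R y| ≤ C * B * T := by
  have hC0 : 0 ≤ C := (abs_nonneg _).trans (hC y)
  have hB0 : 0 ≤ B := (abs_nonneg _).trans (hB R hR hRT y)
  refine (abs_setIntegral_Ioc_le (C := C * B) hR fun u hu => ?_).trans (by gcongr)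
  refine abs_kernel_integral_le fun z => ?_
  rw [abs_mul]
  exact mul_le_mul (hC z) (hB _ (by linarith [hu.2]) (by linarith [hu.1]) z) (abs_nonneg _) hC0

/-- `∫_0^s c(X(u)) du` along the path `ω`. -/
def occupation {S Ω : Type*} (X : ℝ≥0 → Ω → S) (c : S → ℝ) (s : ℝ) (ω : Ω) : ℝ :=
  ∫ u in Set.Ioc 0 s, c (X u.toNNReal ω)

theorem setIntegral_Ioc_ite_le {r T : ℝ} (hr : 0 < r) (hrT : r ≤ T) (ψ : ℝ → ℝ) :
    ∫ s in Set.Ioc 0 T, (if r ≤ s then ψ s else 0) = ∫ u in Set.Ioc 0 (T - r), ψ (r + u) := by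
  have h1 : (fun s => if r ≤ s then ψ s else 0) = (Set.Ici r).indicator ψ := by
    funext s; simp [Set.indicator_apply]
  rw [h1, setIntegral_indicator measurableSet_Ici]
  have h2 : Set.Ioc 0 T ∩ Set.Ici r = Set.Icc r T := by
    ext s; simp only [Set.mem_inter_iff, Set.mem_Ioc, Set.mem_Ici, Set.mem_Icc]
    constructor
    · rintro ⟨⟨_, h⟩, h'⟩; exact ⟨h', h⟩
    · rintro ⟨h, h'⟩; exact ⟨⟨hr.trans_le h, h'⟩, h⟩
  rw [h2, integral_Icc_eq_integral_Ioc, ← intervalIntegral.integral_of_le hrT,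
    ← intervalIntegral.integral_of_le (sub_nonneg.2 hrT),
    intervalIntegral.integral_comp_add_left (fun s => ψ s)]
  simp

theorem abs_occupation_le {S Ω : Type*} {X : ℝ≥0 → Ω → S} {c : S → ℝ} {C : ℝ} (hC : ∀ y, |c y| ≤ C) {s T : ℝ} (hs : 0 ≤ s)
    (hsT : s ≤ T) (ω : Ω) : |occupation X c s ω| ≤ C * T := by
  have hC0 : 0 ≤ C := (abs_nonneg _).trans (hC (X 0 ω))
  exact (abs_setIntegral_Ioc_le hs fun u _ => hC _).trans (by gcongr)

/-! ### Moments of occupation integrals as iterates of the Duhamel operator. -/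

namespace IsMarkovProcessFrom

variable {S Ω : Type*} [MeasurableSpace S] [MeasurableSpace Ω] {κ : Kernel (ℝ≥0 × S) S} {x : S}
  {X : ℝ≥0 → Ω → S} {P : Measure Ω}

theorem measurable_uncurry_toNNReal (hX : IsMarkovProcessFrom κ x X P) :
    Measurable fun p : ℝ × Ω => X p.1.toNNReal p.2 :=
  hX.measurable.comp (f := fun p : ℝ × Ω => (p.1.toNNReal, p.2)) (by fun_prop)

theorem measurable_occupation (hX : IsMarkovProcessFrom κ x X P) {c : S → ℝ} (hc : Measurable c) :
    Measurable (Function.uncurry (occupation X c)) := by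
  refine measurable_setIntegral_Ioc (α := ℝ × Ω) (F := fun p u => c (X u.toNNReal p.2)) ?_
    measurable_fst
  exact hc.comp (hX.measurable_uncurry_toNNReal.comp
    (f := fun q : (ℝ × Ω) × ℝ => (q.2, q.1.2)) (by fun_prop))

theorem aestronglyMeasurable_occupation [IsProbabilityMeasure P]
    (hX : IsMarkovProcessFrom κ x X P) {c : S → ℝ} (hc : Measurable c) {C : ℝ}
    (hC : ∀ y, |c y| ≤ C) (s : ℝ) :
    AEStronglyMeasurable[history X s.toNNReal] (occupation X c s) P := by
  refine aestronglyMeasurable_integral_of_forall_section (hX.history_le _)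
    (Y := fun (u : ℝ) ω => c (X u.toNNReal ω)) (hc.comp hX.measurable_uncurry_toNNReal)
    (fun u ω => hC _) ?_
  filter_upwards [ae_restrict_mem measurableSet_Ioc] with u hu
  exact (hc.comp (measurable_history
    (Real.toNNReal_le_toNNReal hu.2))).stronglyMeasurable.aestronglyMeasurable

theorem occupation_pow_succ (hX : IsMarkovProcessFrom κ x X P) {c : S → ℝ} (hc : Measurable c)
    {C : ℝ} (hC : ∀ y, |c y| ≤ C) (n : ℕ) {s : ℝ} (hs : 0 ≤ s) (ω : Ω) :
    occupation X c s ω ^ (n + 1) =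
      (n + 1) * ∫ r in Set.Ioc 0 s, occupation X c r ω ^ n * c (X r.toNNReal ω) :=
  setIntegral_Ioc_pow (a := fun (u : ℝ) => c (X u.toNNReal ω))
    (hc.comp (hX.measurable_uncurry_toNNReal.of_uncurry_right (f := fun (u : ℝ) ω => X u.toNNReal ω)))
    (fun _ => hC _) n hs

/-- One step of the recursion for the moments, for a globally bounded `H`. -/
theorem integral_occupation_pow_succ_mul_of_bounded [IsProbabilityMeasure P]
    (hX : IsMarkovProcessFrom κ x X P) {c : S → ℝ} (hc : Measurable c) {C : ℝ}
    (hC : ∀ y, |c y| ≤ C) {T : ℝ} {H : ℝ → S → ℝ}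
    (hH : Measurable (Function.uncurry H)) {B : ℝ} (hB : ∀ R y, |H R y| ≤ B) (n : ℕ) :
    ∫ ω, (∫ s in Set.Ioc 0 T,
        occupation X c s ω ^ (n + 1) * (c (X s.toNNReal ω) * H (T - s) (X s.toNNReal ω))) ∂P =
      (n + 1) * ∫ ω, (∫ r in Set.Ioc 0 T,
        occupation X c r ω ^ n *
          (c (X r.toNNReal ω) * duhamel κ c H (T - r) (X r.toNNReal ω))) ∂P := by
  have := hX.transition.isMarkovKernel
  obtain ⟨ω₀⟩ : Nonempty Ω := nonempty_of_isProbabilityMeasure P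
  have hC0 : 0 ≤ C := (abs_nonneg _).trans (hC (X 0 ω₀))
  have hB0 : 0 ≤ B := (abs_nonneg _).trans (hB 0 (X 0 ω₀))
  rcases le_or_gt T 0 with hT | hT
  · simp [Set.Ioc_eq_empty (not_lt.2 hT)]
  let μ : Measure ℝ := volume.restrict (Set.Ioc 0 T)
  have hμ : μ = volume.restrict (Set.Ioc 0 T) := rfl
  -- The cutoff outside (0, T] makes `a` bounded for all r, as the exchange of integrals requires.
  set a : ℝ → Ω → ℝ := fun r ω =>
    if r ∈ Set.Ioc 0 T then occupation X c r ω ^ n * c (X r.toNNReal ω) else 0 with ha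
  set b : ℝ → Ω → ℝ := fun s ω => c (X s.toNNReal ω) * H (T - s) (X s.toNNReal ω) with hb
  set φ : ℝ → ℝ → Ω → ℝ := fun r s ω =>
    ∫ z, c z * H (T - s) z ∂(κ ((s - r).toNNReal, X r.toNNReal ω)) with hφ
  have hXm := hX.measurable_uncurry_toNNReal
  have ham : Measurable (Function.uncurry a) := by
    refine Measurable.ite (measurable_fst measurableSet_Ioc) ?_ measurable_const
    exact ((hX.measurable_occupation hc).pow_const n).mul (hc.comp hXm)
  have hcH : ∀ s y, |c y * H (T - s) y| ≤ C * B := fun s y => by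
    rw [abs_mul]; exact mul_le_mul (hC _) (hB _ _) (abs_nonneg _) hC0
  have hab : ∀ r ω, |a r ω| ≤ (C * T) ^ n * C := fun r ω => by
    simp only [ha]
    split_ifs with h
    · rw [abs_mul, abs_pow]
      have := abs_occupation_le (X := X) hC h.1.le h.2 ω
      gcongr
      exact hC _
    · simp only [abs_zero]; positivity
  set A := (C * T) ^ n * C with hA
  have hA0 : 0 ≤ A := by positivity
  have hbm : Measurable (Function.uncurry b) := by
    refine (hc.comp hXm).mul ?_
    exact hH.comp (f := fun p : ℝ × Ω => (T - p.1, X p.1.toNNReal p.2))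
      ((measurable_const.sub measurable_fst).prodMk hXm)
  have hφm : Measurable fun q : (ℝ × ℝ) × Ω => φ q.1.1 q.1.2 q.2 := by
    refine measurable_kernel_integral (α := (ℝ × ℝ) × Ω)
      (F := fun q z => c z * H (T - q.1.2) z) ?_ (by fun_prop)
      (hXm.comp (f := fun q : (ℝ × ℝ) × Ω => (q.1.1, q.2)) (by fun_prop))
    refine (hc.comp measurable_snd).mul ?_
    exact hH.comp (f := fun q : ((ℝ × ℝ) × Ω) × S => (T - q.1.1.2, q.2)) (by fun_prop)
  have hφb : ∀ r s ω, |φ r s ω| ≤ C * B := fun r s ω => abs_kernel_integral_le (hcH s)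
  -- exchange of the three integrals, for a bounded integrand
  have swap : ∀ G : ℝ → ℝ → Ω → ℝ, Measurable (fun q : (ℝ × ℝ) × Ω => G q.1.1 q.1.2 q.2) →
      (∀ r s ω, |G r s ω| ≤ A * (C * B)) →
      ∫ ω, ∫ r, ∫ s, G r s ω ∂μ ∂μ ∂P = ∫ r, ∫ s, ∫ ω, G r s ω ∂P ∂μ ∂μ := by
    intro G hG hGb
    rw [integral_integral_swap]
    · refine integral_congr_ae (Eventually.of_forall fun r => ?_)
      simp only
      rw [integral_integral_swap]
      refine Integrable.of_bound (C := A * (C * B)) ?_ (Eventually.of_forall fun p => hGb _ _ _)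
      exact (hG.comp (f := fun p : Ω × ℝ => ((r, p.2), p.1)) (by fun_prop)).aestronglyMeasurable
    · refine Integrable.of_bound (C := A * (C * B) * μ.real Set.univ) ?_
        (Eventually.of_forall fun p =>
          norm_integral_le_of_norm_le_const (Eventually.of_forall fun s => hGb _ _ _))
      have : Measurable fun p : (Ω × ℝ) × ℝ => G p.1.2 p.2 p.1.1 :=
        hG.comp (f := fun p : (Ω × ℝ) × ℝ => ((p.1.2, p.2), p.1.1)) (by fun_prop)
      exact this.stronglyMeasurable.integral_prod_right'.aestronglyMeasurable
  have hle : MeasurableSet {q : (ℝ × ℝ) × Ω | q.1.1 ≤ q.1.2} :=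
    measurableSet_le (by fun_prop) (by fun_prop)
  have ham' : Measurable fun q : (ℝ × ℝ) × Ω => a q.1.1 q.2 :=
    ham.comp (f := fun q : (ℝ × ℝ) × Ω => (q.1.1, q.2)) (by fun_prop)
  have hbm' : Measurable fun q : (ℝ × ℝ) × Ω => b q.1.2 q.2 :=
    hbm.comp (f := fun q : (ℝ × ℝ) × Ω => (q.1.2, q.2)) (by fun_prop)
  have swap1 := swap (fun r s ω => if r ≤ s then a r ω * b s ω else 0)
    (Measurable.ite hle (ham'.mul hbm') measurable_const) (fun r s ω => by
      split_ifs
      · rw [abs_mul]; exact mul_le_mul (hab _ _) (hcH _ _) (abs_nonneg _) hA0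
      · simp only [abs_zero]; positivity)
  have swap2 := swap (fun r s ω => if r ≤ s then a r ω * φ r s ω else 0)
    (Measurable.ite hle (ham'.mul hφm) measurable_const) (fun r s ω => by
      split_ifs
      · rw [abs_mul]; exact mul_le_mul (hab _ _) (hφb _ _ _) (abs_nonneg _) hA0
      · simp only [abs_zero]; positivity)
  -- The probabilistic input: conditioning on the past up to r replaces the value at the later time
  -- s by its mean under the transition law over time s − r.
  have markov : ∀ r s, ∫ ω, (if r ≤ s then a r ω * b s ω else 0) ∂P =
      ∫ ω, (if r ≤ s then a r ω * φ r s ω else 0) ∂P := by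
    intro r s
    split_ifs with hrs
    swap; · rfl
    by_cases hr : r ∈ Set.Ioc 0 T
    swap; · simp only [ha, if_neg hr, zero_mul]
    have hy : AEStronglyMeasurable[history X r.toNNReal] (a r) P := by
      have e : a r = fun ω => occupation X c r ω ^ n * c (X r.toNNReal ω) := by
        funext ω; simp only [ha, if_pos hr]
      rw [e]
      exact ((hX.aestronglyMeasurable_occupation hc hC r).pow n).mul
        (hc.comp (measurable_history le_rfl)).stronglyMeasurable.aestronglyMeasurable
    have hm : Measurable fun y => c y * H (T - s) y := hc.mul hH.of_uncurry_left
    have e := hX.integral_mul_comp_add r.toNNReal (s - r).toNNReal hm (hcH s) hy (hab r)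
    rwa [← Real.toNNReal_add hr.1.le (sub_nonneg.2 hrs), add_sub_cancel] at e
  -- One power of the occupation integral is unfolded into an integral over r ≤ s, and the order of
  -- r and s is exchanged.
  have e1 : ∀ ω, ∫ s in Set.Ioc 0 T,
      occupation X c s ω ^ (n + 1) * (c (X s.toNNReal ω) * H (T - s) (X s.toNNReal ω)) =
      (n + 1) * ∫ r, ∫ s, (if r ≤ s then a r ω * b s ω else 0) ∂μ ∂μ := by
    intro ω
    rw [integral_integral_swap, ← integral_const_mul]
    · refine setIntegral_congr_fun measurableSet_Ioc fun s hs => ?_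
      rw [hX.occupation_pow_succ hc hC n hs.1.le, mul_assoc, ← integral_mul_const]
      congr 1
      have h1 : (fun r => if r ≤ s then a r ω * b s ω else 0) =
          (Set.Iic s).indicator fun r => a r ω * b s ω := by
        funext r; simp [Set.indicator_apply]
      rw [h1, hμ, setIntegral_indicator measurableSet_Iic, Set.Ioc_inter_Iic, min_eq_right hs.2]
      refine setIntegral_congr_fun measurableSet_Ioc fun r hr => ?_
      simp only [ha, hb]
      rw [if_pos ⟨hr.1, hr.2.trans hs.2⟩]
    · refine Integrable.of_bound (C := A * (C * B)) ?_ (Eventually.of_forall fun p => ?_)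
      · exact ((Measurable.ite hle (ham'.mul hbm') measurable_const).comp
          (f := fun p : ℝ × ℝ => (p, ω)) (by fun_prop)).aestronglyMeasurable
      · simp only [Function.uncurry, Real.norm_eq_abs]
        split_ifs
        · rw [abs_mul]; exact mul_le_mul (hab _ _) (hcH _ _) (abs_nonneg _) hA0
        · simp only [abs_zero]; positivity
  -- With u = s − r, the inner integral over r ≤ s ≤ T is the Duhamel operator with remaining time T
  -- − r.
  have e2 : ∀ ω, ∫ r in Set.Ioc 0 T, occupation X c r ω ^ n *
        (c (X r.toNNReal ω) * duhamel κ c H (T - r) (X r.toNNReal ω)) =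
      ∫ r, ∫ s, (if r ≤ s then a r ω * φ r s ω else 0) ∂μ ∂μ := by
    intro ω
    refine setIntegral_congr_fun measurableSet_Ioc fun r hr => ?_
    simp only [hμ]
    rw [setIntegral_Ioc_ite_le hr.1 hr.2, integral_const_mul, ← mul_assoc]
    simp only [ha, if_pos hr, hφ, duhamel, sub_sub, add_sub_cancel_left]
  simp_rw [e1, e2]
  rw [integral_const_mul, swap1, swap2]
  simp_rw [markov]

/-- One step of the recursion for the moments. -/
theorem integral_occupation_pow_succ_mul [IsProbabilityMeasure P]
    (hX : IsMarkovProcessFrom κ x X P) {c : S → ℝ} (hc : Measurable c) {C : ℝ}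
    (hC : ∀ y, |c y| ≤ C) {T : ℝ} {H : ℝ → S → ℝ}
    (hH : Measurable (Function.uncurry H)) {B : ℝ}
    (hB : ∀ R, 0 ≤ R → R ≤ T → ∀ y, |H R y| ≤ B) (n : ℕ) :
    ∫ ω, (∫ s in Set.Ioc 0 T,
        occupation X c s ω ^ (n + 1) * (c (X s.toNNReal ω) * H (T - s) (X s.toNNReal ω))) ∂P =
      (n + 1) * ∫ ω, (∫ r in Set.Ioc 0 T,
        occupation X c r ω ^ n *
          (c (X r.toNNReal ω) * duhamel κ c H (T - r) (X r.toNNReal ω))) ∂P := by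
  rcases lt_or_ge T 0 with hT | hT
  · simp [Set.Ioc_eq_empty (not_lt.2 hT.le)]
  obtain ⟨ω₀⟩ : Nonempty Ω := nonempty_of_isProbabilityMeasure P
  have hB0 : 0 ≤ B := (abs_nonneg _).trans (hB 0 le_rfl hT (X 0 ω₀))
  -- Duhamel iterates are bounded only for times in [0, T], but both sides see `H` only there, so
  -- truncation is harmless.
  set H' : ℝ → S → ℝ := fun R y => if R ∈ Set.Icc 0 T then H R y else 0 with hH'
  have h := hX.integral_occupation_pow_succ_mul_of_bounded hc hC (T := T) (H := H')
    (Measurable.ite (measurable_fst measurableSet_Icc) hH measurable_const) (B := B)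
    (fun R y => by
      simp only [hH']
      split_ifs with h
      · exact hB R h.1 h.2 y
      · simpa using hB0) n
  refine Eq.trans (integral_congr_ae (Eventually.of_forall fun ω => ?_)) (h.trans ?_)
  · refine setIntegral_congr_fun measurableSet_Ioc fun s hs => ?_
    have : T - s ∈ Set.Icc 0 T := ⟨by linarith [hs.2], by linarith [hs.1]⟩
    simp only [hH', if_pos this]
  · congr 1
    refine integral_congr_ae (Eventually.of_forall fun ω => ?_)
    refine setIntegral_congr_fun measurableSet_Ioc fun r hr => ?_
    congr 2
    refine setIntegral_congr_fun measurableSet_Ioc fun (s : ℝ) (hs : s ∈ Set.Ioc 0 (T - r)) => ?_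
    have : T - r - s ∈ Set.Icc 0 T := ⟨by linarith [hs.2], by linarith [hs.1, hr.1]⟩
    simp only [hH', if_pos this]

/-- Each step of the induction trades one power of the occupation integral for a numerical factor
and one application of D to `H`; hence `H` must stay general. -/
theorem integral_occupation_pow_mul [IsProbabilityMeasure P]
    (hX : IsMarkovProcessFrom κ x X P) {c : S → ℝ} (hc : Measurable c) {C : ℝ}
    (hC : ∀ y, |c y| ≤ C) {T : ℝ} (n : ℕ) {H : ℝ → S → ℝ}
    (hH : Measurable (Function.uncurry H)) {B : ℝ}
    (hB : ∀ R, 0 ≤ R → R ≤ T → ∀ y, |H R y| ≤ B) :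
    ∫ ω, (∫ s in Set.Ioc 0 T,
        occupation X c s ω ^ n * (c (X s.toNNReal ω) * H (T - s) (X s.toNNReal ω))) ∂P =
      n.factorial * (duhamel κ c)^[n + 1] H T x := by
  have := hX.transition.isMarkovKernel
  obtain ⟨ω₀⟩ : Nonempty Ω := nonempty_of_isProbabilityMeasure P
  have hC0 : 0 ≤ C := (abs_nonneg _).trans (hC (X 0 ω₀))
  induction n generalizing H B with
  | zero =>
    rcases lt_or_ge T 0 with hT | hT
    · simp [Set.Ioc_eq_empty (not_lt.2 hT.le), duhamel]
    have hcH : ∀ s ∈ Set.Ioc 0 T, ∀ y, |c y * H (T - s) y| ≤ C * B := fun s hs y => by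
      rw [abs_mul]
      exact mul_le_mul (hC _) (hB _ (by linarith [hs.2]) (by linarith [hs.1]) _) (abs_nonneg _) hC0
    have hXm := hX.measurable_uncurry_toNNReal
    simp only [pow_zero, one_mul, Nat.factorial_zero, Nat.cast_one, zero_add, Function.iterate_one]
    rw [integral_integral_swap]
    · refine setIntegral_congr_fun measurableSet_Ioc fun s hs => ?_
      exact hX.integral_comp s.toNNReal (h := fun y => c y * H (T - s) y)
        (hc.mul hH.of_uncurry_left) (hcH s hs)
    · have hm : Measurable fun p : Ω × ℝ =>
          c (X p.2.toNNReal p.1) * H (T - p.2) (X p.2.toNNReal p.1) := by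
        have h1 : Measurable fun p : Ω × ℝ => X p.2.toNNReal p.1 := hXm.comp measurable_swap
        exact (hc.comp h1).mul (hH.comp (f := fun p : Ω × ℝ => (T - p.2, X p.2.toNNReal p.1))
          ((measurable_const.sub measurable_snd).prodMk h1))
      refine Integrable.of_bound (C := C * B) hm.aestronglyMeasurable ?_
      have hms : MeasurableSet {p : Ω × ℝ | p.2 ∈ Set.Ioc 0 T} := measurable_snd measurableSet_Ioc
      have h2 : ∀ᵐ p ∂P.prod (volume.restrict (Set.Ioc (0 : ℝ) T)), p.2 ∈ Set.Ioc 0 T :=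
        (Measure.ae_prod_iff_ae_ae hms).2
          (Eventually.of_forall fun ω => ae_restrict_mem measurableSet_Ioc)
      filter_upwards [h2] with p hp
      exact hcH p.2 hp _
  | succ n ih =>
    rw [hX.integral_occupation_pow_succ_mul hc hC hH hB n,
      ih (measurable_duhamel hc hH) (B := C * B * T)
        fun R hR hRT y => abs_duhamel_le hC hB hR hRT y,
      ← Function.iterate_succ_apply, Nat.factorial_succ]
    push_cast
    ring

/-- The moments of `∫_0^T c(X(u)) du`. -/
theorem integral_occupation_pow [IsProbabilityMeasure P]
    (hX : IsMarkovProcessFrom κ x X P) {c : S → ℝ} (hc : Measurable c) {C : ℝ}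
    (hC : ∀ y, |c y| ≤ C) {T : ℝ} (hT : 0 ≤ T) (n : ℕ) :
    ∫ ω, occupation X c T ω ^ (n + 1) ∂P =
      (n + 1).factorial * (duhamel κ c)^[n + 1] (fun _ _ => 1) T x := by
  have h := hX.integral_occupation_pow_mul hc hC (T := T) n (H := fun _ _ => 1)
    measurable_const (B := 1) (by simp)
  simp_rw [hX.occupation_pow_succ hc hC n hT]
  simp only [mul_one] at h
  rw [integral_const_mul, h, Nat.factorial_succ]
  push_cast
  ring

end IsMarkovProcessFrom

/-! ### Consequences of geometric ergodicity and growth of the Duhamel iterates. -/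

theorem abs_integral_le_of_abs_le {β : Type*} [MeasurableSpace β] {μ : Measure β} {h b : β → ℝ}
    (hb : Integrable b μ) (hle : ∀ᵐ y ∂μ, |h y| ≤ b y) : |∫ y, h y ∂μ| ≤ ∫ y, b y ∂μ :=
  norm_integral_le_of_norm_le (f := h) hb hle

theorem setIntegral_Ioc_exp_neg_mul_le {α : ℝ} (hα : 0 < α) (R : ℝ) :
    ∫ u in Set.Ioc 0 R, Real.exp (-α * u) ≤ 1 / α := by
  have hi : IntegrableOn (fun u => Real.exp (-α * u)) (Set.Ioi 0) :=
    exp_neg_integrableOn_Ioi 0 hα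
  refine (setIntegral_mono_set hi (Eventually.of_forall fun u => (Real.exp_pos _).le)
    (Set.Ioc_subset_Ioi_self.eventuallyLE)).trans ?_
  rw [integral_exp_mul_Ioi (by linarith)]
  simp [neg_div_neg_eq]

theorem integrableOn_Ioc_exp_neg_mul (α R : ℝ) :
    IntegrableOn (fun u => Real.exp (-α * u)) (Set.Ioc 0 R) :=
  (Continuous.integrableOn_Icc (by fun_prop)).mono_set Set.Ioc_subset_Icc_self

/-- Geometric ergodicity in the form used for functions of at most the size of a multiple
of `v`. -/
structure HasErgodicBound {S : Type*} [MeasurableSpace S] (κ : Kernel (ℝ≥0 × S) S) (v : S → ℝ)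
    (π : Measure S) (d α : ℝ) : Prop where
  toIsGeometricallyErgodic : IsGeometricallyErgodic κ v π
  nonneg : 0 ≤ d
  pos : 0 < α
  bound : ∀ (t : ℝ≥0) (x : S) (h : S → ℝ) (K : ℝ), Measurable h → 0 ≤ K →
    (∀ y, |h y| ≤ K * v y) →
      |∫ y, h y ∂(κ (t, x)) - ∫ y, h y ∂π| ≤ K * d * v x * Real.exp (-α * t)

theorem IsGeometricallyErgodic.exists_hasErgodicBound {S : Type*} [MeasurableSpace S]
    {κ : Kernel (ℝ≥0 × S) S} {v : S → ℝ} {π : Measure S} (hκ : IsGeometricallyErgodic κ v π) :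
    ∃ d α, HasErgodicBound κ v π d α := by
  obtain ⟨d, α, hα, hb⟩ := hκ.bound
  refine ⟨max d 0, α, hκ, le_max_right _ _, hα, fun t x h K hh hK hhK => ?_⟩
  have hv : ∀ x, 0 < v x := fun x => one_pos.trans_le (hκ.one_le x)
  -- The general case rescales h by 1/K, so K = 0 is separate.
  rcases hK.eq_or_lt with rfl | hK
  · have : h = fun _ => 0 := funext fun y => abs_nonpos_iff.1 (by simpa using hhK y)
    simp [this]
  have h1 := hb t x (fun y => K⁻¹ * h y) (hh.const_mul _) fun y => by
    rw [abs_mul, abs_of_pos (inv_pos.2 hK), inv_mul_le_iff₀ hK]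
    exact hhK y
  rw [integral_const_mul, integral_const_mul, ← mul_sub, abs_mul, abs_of_pos (inv_pos.2 hK),
    inv_mul_le_iff₀ hK] at h1
  refine h1.trans ?_
  have := hv x
  rw [mul_assoc K, mul_assoc K]
  gcongr
  exact le_max_left _ _

namespace HasErgodicBound

variable {S : Type*} [MeasurableSpace S] {κ : Kernel (ℝ≥0 × S) S} {v : S → ℝ} {π : Measure S}
  {d α : ℝ}

theorem integral_nonneg (hκ : HasErgodicBound κ v π d α) : 0 ≤ ∫ y, v y ∂π :=
  MeasureTheory.integral_nonneg fun y => zero_le_one.trans (hκ.toIsGeometricallyErgodic.one_le y)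

theorem weight_pos (hκ : HasErgodicBound κ v π d α) (y : S) : 0 < v y :=
  one_pos.trans_le (hκ.toIsGeometricallyErgodic.one_le y)

theorem integrable_kernel (hκ : HasErgodicBound κ v π d α) (t : ℝ≥0) (x : S) {h : S → ℝ}
    (hh : Measurable h) {K : ℝ} (hK : ∀ y, |h y| ≤ K * v y) : Integrable h (κ (t, x)) :=
  ((hκ.toIsGeometricallyErgodic.integrable t x).const_mul K).mono' hh.aestronglyMeasurable
    (Eventually.of_forall hK)

theorem integrable_limit (hκ : HasErgodicBound κ v π d α) {h : S → ℝ}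
    (hh : Measurable h) {K : ℝ} (hK : ∀ y, |h y| ≤ K * v y) : Integrable h π :=
  (hκ.toIsGeometricallyErgodic.integrable_limit.const_mul K).mono' hh.aestronglyMeasurable
    (Eventually.of_forall hK)

theorem abs_integral_limit_le (hκ : HasErgodicBound κ v π d α) {h : S → ℝ}
    {K : ℝ} (hK : ∀ y, |h y| ≤ K * v y) : |∫ y, h y ∂π| ≤ K * ∫ y, v y ∂π := by
  rw [← integral_const_mul]
  exact abs_integral_le_of_abs_le (hκ.toIsGeometricallyErgodic.integrable_limit.const_mul K)
    (Eventually.of_forall hK)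

/-- Comparison with the limit law, together with v ≥ 1, shows that the transition operators preserve
the class O(v) uniformly in time. -/
theorem abs_integral_kernel_le (hκ : HasErgodicBound κ v π d α) (t : ℝ≥0) (x : S) {h : S → ℝ}
    (hh : Measurable h) {K : ℝ} (hK0 : 0 ≤ K) (hK : ∀ y, |h y| ≤ K * v y) :
    |∫ y, h y ∂(κ (t, x))| ≤ K * (d + ∫ y, v y ∂π) * v x := by
  have h1 := hκ.bound t x h K hh hK0 hK
  have h2 := hκ.abs_integral_limit_le hK
  have h3 : Real.exp (-α * t) ≤ 1 := Real.exp_le_one_iff.2 (by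
    have := mul_nonneg hκ.pos.le t.2; simpa using this)
  have h4 := hκ.toIsGeometricallyErgodic.one_le x
  have h5 := hκ.integral_nonneg
  have h6 := hκ.nonneg
  have h7 : |∫ y, h y ∂(κ (t, x))| ≤
      |∫ y, h y ∂(κ (t, x)) - ∫ y, h y ∂π| + |∫ y, h y ∂π| := by
    simpa using abs_add_le (∫ y, h y ∂(κ (t, x)) - ∫ y, h y ∂π) (∫ y, h y ∂π)
  have h8 : K * d * v x * Real.exp (-α * t) ≤ K * d * v x * 1 :=
    mul_le_mul_of_nonneg_left h3 (by have := hκ.weight_pos x; positivity)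
  have h9 : K * (∫ y, v y ∂π) * 1 ≤ K * (∫ y, v y ∂π) * v x :=
    mul_le_mul_of_nonneg_left h4 (by positivity)
  linarith

theorem abs_mul_le (_ : HasErgodicBound κ v π d α) {c : S → ℝ} {C : ℝ} (hC : ∀ y, |c y| ≤ C)
    {h : S → ℝ} {K : ℝ} (hK : ∀ y, |h y| ≤ K * v y) (y : S) : |c y * h y| ≤ C * K * v y := by
  rw [abs_mul, mul_assoc]
  exact mul_le_mul (hC y) (hK y) (abs_nonneg _) ((abs_nonneg _).trans (hC y))

theorem abs_le_mul_weight (hκ : HasErgodicBound κ v π d α) {c : S → ℝ} {C : ℝ}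
    (hC : ∀ y, |c y| ≤ C) (y : S) : |c y| ≤ C * v y :=
  (hC y).trans (le_mul_of_one_le_right ((abs_nonneg _).trans (hC y))
    (hκ.toIsGeometricallyErgodic.one_le y))

/-- The square of the Duhamel operator of a centered function grows only linearly in time. -/
theorem abs_duhamel_duhamel_le [IsMarkovKernel κ] (hκ : HasErgodicBound κ v π d α)
    {c : S → ℝ} (hc : Measurable c) {C : ℝ} (hC : ∀ y, |c y| ≤ C) (hc0 : ∫ y, c y ∂π = 0)
    {H : ℝ → S → ℝ} (hH : Measurable (Function.uncurry H)) {K T : ℝ} (hK0 : 0 ≤ K)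
    (hK : ∀ R, 0 ≤ R → R ≤ T → ∀ y, |H R y| ≤ K * v y) {R : ℝ} (hR : 0 ≤ R) (hRT : R ≤ T)
    (y : S) :
    |duhamel κ c (duhamel κ c H) R y| ≤
      K * (C ^ 2 * d * (d + 2 * ∫ z, v z ∂π) / α * T) * v y := by
  have := hκ.toIsGeometricallyErgodic.isProbabilityMeasure
  have hT : 0 ≤ T := hR.trans hRT
  have hα := hκ.pos
  have hd := hκ.nonneg
  have hC0 : 0 ≤ C := (abs_nonneg _).trans (hC y)
  have hp := hκ.integral_nonneg
  set p := ∫ z, v z ∂π with hpdef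
  have hv := hκ.weight_pos
  -- Replacing the transition law by π gives a part `q` that may grow like T but does not depend on
  -- y; by ergodicity the error is O(v) uniformly in time (`heb`).
  set q : ℝ → ℝ := fun R => ∫ u in Set.Ioc 0 R, ∫ z, c z * H (R - u) z ∂π with hq
  have hcHm : ∀ R u, Measurable fun z => c z * H (R - u) z := fun R u =>
    hc.mul hH.of_uncurry_left
  have hcHb : ∀ R, 0 ≤ R → R ≤ T → ∀ u ∈ Set.Ioc 0 R, ∀ z, |c z * H (R - u) z| ≤ C * K * v z :=
    fun R h0 h1 u hu => hκ.abs_mul_le hC (hK _ (by linarith [hu.2]) (by linarith [hu.1]))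
  have hqb : ∀ R, 0 ≤ R → R ≤ T → |q R| ≤ C * K * p * T := fun R h0 h1 =>
    (abs_setIntegral_Ioc_le h0 fun u hu => hκ.abs_integral_limit_le (hcHb R h0 h1 u hu)).trans
      (by gcongr)
  have heb : ∀ R, 0 ≤ R → R ≤ T → ∀ y, |duhamel κ c H R y - q R| ≤ C * K * d / α * v y := by
    intro R h0 h1 y
    have m0 : Measurable fun r : ℝ × S => c r.2 * H (R - r.1) r.2 :=
      (hc.comp measurable_snd).mul (hH.comp (f := fun r : ℝ × S => (R - r.1, r.2)) (by fun_prop))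
    have m1 : Measurable fun u : ℝ => ∫ z, c z * H (R - u) z ∂(κ (u.toNNReal, y)) :=
      measurable_kernel_integral (F := fun u z => c z * H (R - u) z) m0
        measurable_real_toNNReal measurable_const
    have m2 : Measurable fun u : ℝ => ∫ z, c z * H (R - u) z ∂π :=
      (m0.stronglyMeasurable.integral_prod_right' (ν := π)).measurable
    have i1 : IntegrableOn (fun u : ℝ => ∫ z, c z * H (R - u) z ∂(κ (u.toNNReal, y)))
        (Set.Ioc 0 R) := by
      refine Measure.integrableOn_of_bounded (M := C * K * (d + p) * v y) (by simp)
        m1.aestronglyMeasurable ?_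
      filter_upwards [ae_restrict_mem measurableSet_Ioc] with u hu
      exact hκ.abs_integral_kernel_le _ _ (hcHm R u) (by positivity) (hcHb R h0 h1 u hu)
    have i2 : IntegrableOn (fun u : ℝ => ∫ z, c z * H (R - u) z ∂π) (Set.Ioc 0 R) := by
      refine Measure.integrableOn_of_bounded (M := C * K * p) (by simp)
        m2.aestronglyMeasurable ?_
      filter_upwards [ae_restrict_mem measurableSet_Ioc] with u hu
      exact hκ.abs_integral_limit_le (hcHb R h0 h1 u hu)
    rw [duhamel, hq, ← integral_sub i1 i2]
    refine (abs_integral_le_of_abs_le (b := fun u => C * K * d * v y * Real.exp (-α * u))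
      ((integrableOn_Ioc_exp_neg_mul α R).const_mul _) ?_).trans ?_
    · filter_upwards [ae_restrict_mem measurableSet_Ioc] with u hu
      have := hκ.bound u.toNNReal y _ (C * K) (hcHm R u) (by positivity) (hcHb R h0 h1 u hu)
      rwa [Real.coe_toNNReal _ hu.1.le] at this
    · rw [integral_const_mul]
      have := mul_le_mul_of_nonneg_left (setIntegral_Ioc_exp_neg_mul_le hα R)
        (show 0 ≤ C * K * d * v y by have := hv y; positivity)
      refine this.trans (le_of_eq ?_)
      ring
  have hdm := measurable_duhamel (κ := κ) hc hH
  have hpt : ∀ u ∈ Set.Ioc 0 R, |∫ z, c z * duhamel κ c H (R - u) z ∂(κ (u.toNNReal, y))| ≤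
      C * K * p * T * (C * d * v y) * Real.exp (-α * u) +
        C * (C * K * d / α) * (d + p) * v y := by
    intro u hu
    have r0 : 0 ≤ R - u := by linarith [hu.2]
    have r1 : R - u ≤ T := by linarith [hu.1]
    have em : Measurable fun z => c z * (duhamel κ c H (R - u) z - q (R - u)) :=
      hc.mul (hdm.of_uncurry_left.sub_const _)
    have eb := hκ.abs_mul_le hC (heb _ r0 r1)
    -- The growing factor q(R − u) multiplies E_y c(X(u)), which decays exponentially because c is
    -- centered, while the other term carries no factor T. After integration over u, each is O(T).
    have e1 : ∫ z, c z * duhamel κ c H (R - u) z ∂(κ (u.toNNReal, y)) =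
        q (R - u) * ∫ z, c z ∂(κ (u.toNNReal, y)) +
          ∫ z, c z * (duhamel κ c H (R - u) z - q (R - u)) ∂(κ (u.toNNReal, y)) := by
      rw [← integral_const_mul, ← integral_add]
      · refine integral_congr_ae (Eventually.of_forall fun z => ?_)
        simp only
        ring
      · exact (hκ.integrable_kernel _ _ hc (hκ.abs_le_mul_weight hC)).const_mul _
      · exact hκ.integrable_kernel _ _ em eb
    rw [e1]
    refine (abs_add_le _ _).trans (add_le_add ?_ ?_)
    · rw [abs_mul, mul_assoc _ (C * d * v y)]
      have := hκ.bound u.toNNReal y c C hc hC0 (hκ.abs_le_mul_weight hC)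
      rw [Real.coe_toNNReal _ hu.1.le, hc0, sub_zero] at this
      exact mul_le_mul (hqb _ r0 r1) this (abs_nonneg _) (by positivity)
    · exact hκ.abs_integral_kernel_le _ _ em (by positivity) eb
  have hvy := hv y
  rw [duhamel]
  refine (abs_integral_le_of_abs_le (b := fun u => C * K * p * T * (C * d * v y) *
    Real.exp (-α * u) + C * (C * K * d / α) * (d + p) * v y) ?_ ?_).trans ?_
  · exact ((integrableOn_Ioc_exp_neg_mul α R).const_mul _).add (integrable_const _)
  · filter_upwards [ae_restrict_mem measurableSet_Ioc] with u hu
    exact hpt u hu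
  · rw [integral_add ((integrableOn_Ioc_exp_neg_mul α R).const_mul _) (integrable_const _),
      integral_const_mul, integral_const]
    have a1 := mul_le_mul_of_nonneg_left (setIntegral_Ioc_exp_neg_mul_le hα R)
      (show 0 ≤ C * K * p * T * (C * d * v y) by positivity)
    have a2 : (volume.restrict (Set.Ioc 0 R)).real Set.univ = R := by
      simp [measureReal_def, hR]
    have a3 : R * (C * (C * K * d / α) * (d + p) * v y) ≤
        T * (C * (C * K * d / α) * (d + p) * v y) :=
      mul_le_mul_of_nonneg_right hRT (by positivity)
    rw [a2, smul_eq_mul]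
    refine (add_le_add a1 a3).trans (le_of_eq ?_)
    field_simp
    ring

end HasErgodicBound

/-! ### The potential and the sharp asymptotics of the first two iterates. -/

/-- `y ↦ ∫_0^∞ E_y c(X(t)) dt`. -/
def greenPotential {S : Type*} [MeasurableSpace S] (κ : Kernel (ℝ≥0 × S) S) (c : S → ℝ)
    (y : S) : ℝ :=
  ∫ s in Set.Ioi (0 : ℝ), ∫ z, c z ∂(κ (s.toNNReal, y))

namespace HasErgodicBound

variable {S : Type*} [MeasurableSpace S] {κ : Kernel (ℝ≥0 × S) S} {v : S → ℝ} {π : Measure S}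
  {d α : ℝ} {c : S → ℝ} {C : ℝ}

theorem abs_kernel_integral_centered_le (hκ : HasErgodicBound κ v π d α) (hc : Measurable c)
    (hC : ∀ y, |c y| ≤ C) (hc0 : ∫ y, c y ∂π = 0) (y : S) {u : ℝ} (hu : 0 ≤ u) :
    |∫ z, c z ∂(κ (u.toNNReal, y))| ≤ C * d * v y * Real.exp (-α * u) := by
  have h := hκ.bound u.toNNReal y c C hc ((abs_nonneg _).trans (hC y)) (hκ.abs_le_mul_weight hC)
  rwa [hc0, sub_zero, Real.coe_toNNReal _ hu] at h

theorem measurable_kernel_integral_time [IsMarkovKernel κ] (hc : Measurable c) :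
    Measurable fun p : S × ℝ => ∫ z, c z ∂(κ (p.2.toNNReal, p.1)) :=
  measurable_kernel_integral (F := fun _ z => c z) (hc.comp measurable_snd) (by fun_prop)
    measurable_fst

theorem integrableOn_kernel_integral [IsMarkovKernel κ] (hκ : HasErgodicBound κ v π d α)
    (hc : Measurable c) (hC : ∀ y, |c y| ≤ C) (hc0 : ∫ y, c y ∂π = 0) (y : S) :
    IntegrableOn (fun s : ℝ => ∫ z, c z ∂(κ (s.toNNReal, y))) (Set.Ioi 0) := by
  refine ((exp_neg_integrableOn_Ioi 0 hκ.pos).const_mul (C * d * v y)).mono'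
    ((measurable_kernel_integral_time hc).of_uncurry_left (f := fun y (s : ℝ) =>
      ∫ z, c z ∂(κ (s.toNNReal, y)))).aestronglyMeasurable ?_
  filter_upwards [ae_restrict_mem measurableSet_Ioi] with u hu
  exact hκ.abs_kernel_integral_centered_le hc hC hc0 y (le_of_lt hu)

theorem measurable_greenPotential [IsMarkovKernel κ] (hc : Measurable c) :
    Measurable (greenPotential κ c) :=
  ((measurable_kernel_integral_time hc).stronglyMeasurable.integral_prod_right').measurable

/-- The difference is the tail over (R, ∞) of an integral with exponentially decaying integrand. -/
theorem abs_greenPotential_sub_duhamel_one_le [IsMarkovKernel κ]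
    (hκ : HasErgodicBound κ v π d α) (hc : Measurable c) (hC : ∀ y, |c y| ≤ C)
    (hc0 : ∫ y, c y ∂π = 0) (y : S) {R : ℝ} (hR : 0 ≤ R) :
    |greenPotential κ c y - duhamel κ c (fun _ _ => 1) R y| ≤
      C * d / α * Real.exp (-α * R) * v y := by
  have hi := hκ.integrableOn_kernel_integral hc hC hc0 y
  have hα := hκ.pos
  have e : greenPotential κ c y - duhamel κ c (fun _ _ => 1) R y =
      ∫ s in Set.Ioi R, ∫ z, c z ∂(κ (s.toNNReal, y)) := by
    rw [greenPotential, duhamel, ← Set.Ioc_union_Ioi_eq_Ioi hR,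
      setIntegral_union (Set.Ioc_disjoint_Ioi le_rfl) measurableSet_Ioi
        (hi.mono_set Set.Ioc_subset_Ioi_self) (hi.mono_set (Set.Ioi_subset_Ioi hR))]
    simp
  rw [e]
  refine (abs_integral_le_of_abs_le (b := fun u => C * d * v y * Real.exp (-α * u))
    ((exp_neg_integrableOn_Ioi R hα).const_mul _) ?_).trans (le_of_eq ?_)
  · filter_upwards [ae_restrict_mem measurableSet_Ioi] with u hu
    exact hκ.abs_kernel_integral_centered_le hc hC hc0 y (hR.trans (le_of_lt hu))
  · rw [integral_const_mul, integral_exp_mul_Ioi (by linarith)]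
    field_simp

/-- This is the tail estimate at R = 0, where the Duhamel integral is empty. -/
theorem abs_greenPotential_le [IsMarkovKernel κ]
    (hκ : HasErgodicBound κ v π d α) (hc : Measurable c) (hC : ∀ y, |c y| ≤ C)
    (hc0 : ∫ y, c y ∂π = 0) (y : S) : |greenPotential κ c y| ≤ C * d / α * v y := by
  simpa [duhamel] using hκ.abs_greenPotential_sub_duhamel_one_le hc hC hc0 y le_rfl

theorem abs_duhamel_one_le [IsMarkovKernel κ]
    (hκ : HasErgodicBound κ v π d α) (hc : Measurable c) (hC : ∀ y, |c y| ≤ C)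
    (hc0 : ∫ y, c y ∂π = 0) (y : S) {R : ℝ} (hR : 0 ≤ R) :
    |duhamel κ c (fun _ _ => 1) R y| ≤ 2 * (C * d / α) * v y := by
  have h1 := hκ.abs_greenPotential_sub_duhamel_one_le hc hC hc0 y hR
  have h2 := hκ.abs_greenPotential_le hc hC hc0 y
  have hα := hκ.pos
  have hd := hκ.nonneg
  have hC0 : 0 ≤ C := (abs_nonneg _).trans (hC y)
  have hv := hκ.weight_pos y
  have h3 : Real.exp (-α * R) ≤ 1 := Real.exp_le_one_iff.2 (by nlinarith)
  have h4 : C * d / α * Real.exp (-α * R) * v y ≤ C * d / α * 1 * v y := by gcongr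
  have h5 := abs_sub_abs_le_abs_sub (duhamel κ c (fun _ _ => 1) R y) (greenPotential κ c y)
  rw [abs_sub_comm] at h5
  linarith

theorem tendsto_duhamel_one [IsMarkovKernel κ]
    (hκ : HasErgodicBound κ v π d α) (hc : Measurable c) (hC : ∀ y, |c y| ≤ C)
    (hc0 : ∫ y, c y ∂π = 0) (y : S) :
    Tendsto (fun R => duhamel κ c (fun _ _ => 1) R y) atTop (𝓝 (greenPotential κ c y)) := by
  rw [tendsto_iff_norm_sub_tendsto_zero]
  have h : Tendsto (fun R => C * d / α * Real.exp (-α * R) * v y) atTop (𝓝 0) := by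
    have : Tendsto (fun R => Real.exp (-α * R)) atTop (𝓝 0) :=
      Real.tendsto_exp_atBot.comp
        ((tendsto_const_mul_atBot_of_neg (neg_lt_zero.2 hκ.pos)).2 tendsto_id)
    simpa using (this.const_mul (C * d / α)).mul_const (v y)
  refine squeeze_zero' (Eventually.of_forall fun _ => norm_nonneg _) ?_ h
  filter_upwards [eventually_ge_atTop 0] with R hR
  rw [Real.norm_eq_abs, abs_sub_comm]
  exact hκ.abs_greenPotential_sub_duhamel_one_le hc hC hc0 y hR

theorem abs_mul_greenPotential_le [IsMarkovKernel κ] (hκ : HasErgodicBound κ v π d α)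
    (hc : Measurable c) (hC : ∀ y, |c y| ≤ C) (hc0 : ∫ y, c y ∂π = 0) (y : S) :
    |c y * greenPotential κ c y| ≤ C * (C * d / α) * v y :=
  hκ.abs_mul_le hC (hκ.abs_greenPotential_le hc hC hc0) y

theorem integrable_mul_greenPotential [IsMarkovKernel κ] (hκ : HasErgodicBound κ v π d α)
    (hc : Measurable c) (hC : ∀ y, |c y| ≤ C) (hc0 : ∫ y, c y ∂π = 0) :
    Integrable (fun y => c y * greenPotential κ c y) π :=
  hκ.integrable_limit (hc.mul (measurable_greenPotential hc))
    (hκ.abs_mul_greenPotential_le hc hC hc0)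

/-- The second iterate grows linearly in time, up to a bounded error. -/
theorem abs_duhamel_duhamel_one_sub_le [IsMarkovKernel κ] (hκ : HasErgodicBound κ v π d α)
    (hc : Measurable c) (hC : ∀ y, |c y| ≤ C) (hc0 : ∫ y, c y ∂π = 0) (y : S) {T : ℝ}
    (hT : 0 ≤ T) :
    |duhamel κ c (duhamel κ c fun _ _ => 1) T y - T * ∫ z, c z * greenPotential κ c z ∂π| ≤
      C ^ 2 * d / α * (2 * d + ∫ z, v z ∂π) * v y / α := by
  have hα := hκ.pos
  have hd := hκ.nonneg
  have hC0 : 0 ≤ C := (abs_nonneg _).trans (hC y)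
  have hv := hκ.weight_pos y
  have hp := hκ.integral_nonneg
  set p := ∫ z, v z ∂π
  set σ := ∫ z, c z * greenPotential κ c z ∂π
  have hDm : Measurable (Function.uncurry (duhamel κ c fun _ _ => 1)) :=
    measurable_duhamel hc measurable_const
  have hGm := measurable_greenPotential (κ := κ) hc
  -- Two replacements: the potential truncated at T − u by the full one, at cost e^{-α(T-u)}, then
  -- the law at time u by π, at cost e^{-αu}. Each cost integrates to at most 1/α.
  have hpt : ∀ u ∈ Set.Ioc 0 T,
      |∫ z, c z * duhamel κ c (fun _ _ => 1) (T - u) z ∂(κ (u.toNNReal, y)) - σ| ≤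
      C * (C * d / α) * (d + p) * v y * Real.exp (-α * (T - u)) +
        C * (C * d / α) * d * v y * Real.exp (-α * u) := by
    intro u hu
    have b1 := hκ.abs_mul_le hC (fun z =>
      hκ.abs_greenPotential_sub_duhamel_one_le hc hC hc0 z (sub_nonneg.2 hu.2))
    have m1 : Measurable fun z =>
        c z * (greenPotential κ c z - duhamel κ c (fun _ _ => 1) (T - u) z) :=
      hc.mul (hGm.sub hDm.of_uncurry_left)
    have b2 := hκ.abs_mul_greenPotential_le hc hC hc0
    have m2 : Measurable fun z => c z * greenPotential κ c z := hc.mul hGm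
    have e : ∫ z, c z * duhamel κ c (fun _ _ => 1) (T - u) z ∂(κ (u.toNNReal, y)) - σ =
        (∫ z, c z * greenPotential κ c z ∂(κ (u.toNNReal, y)) - σ) -
        ∫ z, c z * (greenPotential κ c z - duhamel κ c (fun _ _ => 1) (T - u) z)
          ∂(κ (u.toNNReal, y)) := by
      rw [sub_right_comm, ← integral_sub (hκ.integrable_kernel _ _ m2 b2)
        (hκ.integrable_kernel _ _ m1 b1)]
      congr 1
      refine integral_congr_ae (Eventually.of_forall fun z => ?_)
      simp only
      ring
    have h1 := hκ.bound u.toNNReal y _ _ m2 (by positivity) b2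
    rw [Real.coe_toNNReal _ hu.1.le] at h1
    have h2 := hκ.abs_integral_kernel_le u.toNNReal y m1 (by positivity) b1
    rw [e]
    refine (abs_sub _ _).trans ?_
    rw [add_comm]
    refine add_le_add (h2.trans (le_of_eq ?_)) h1
    ring
  have i2 := integrableOn_Ioc_exp_neg_mul α T
  have i1 : IntegrableOn (fun u => Real.exp (-α * (T - u))) (Set.Ioc 0 T) :=
    (Continuous.integrableOn_Icc (by fun_prop)).mono_set Set.Ioc_subset_Icc_self
  have e1 : ∫ u in Set.Ioc 0 T, Real.exp (-α * (T - u)) =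
      ∫ u in Set.Ioc 0 T, Real.exp (-α * u) := by
    rw [← intervalIntegral.integral_of_le hT, ← intervalIntegral.integral_of_le hT,
      intervalIntegral.integral_comp_sub_left (fun u => Real.exp (-α * u))]
    simp
  have m3 : Measurable fun u : ℝ =>
      ∫ z, c z * duhamel κ c (fun _ _ => 1) (T - u) z ∂(κ (u.toNNReal, y)) :=
    measurable_kernel_integral (F := fun u z => c z * duhamel κ c (fun _ _ => 1) (T - u) z)
      ((hc.comp measurable_snd).mul
        (hDm.comp (f := fun r : ℝ × S => (T - r.1, r.2)) (by fun_prop)))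
      measurable_real_toNNReal measurable_const
  have ib : IntegrableOn (fun u => C * (C * d / α) * (d + p) * v y * Real.exp (-α * (T - u)) +
        C * (C * d / α) * d * v y * Real.exp (-α * u)) (Set.Ioc 0 T) :=
    (i1.const_mul _).add (i2.const_mul _)
  have hdi : IntegrableOn (fun u : ℝ =>
      ∫ z, c z * duhamel κ c (fun _ _ => 1) (T - u) z ∂(κ (u.toNNReal, y)) - σ)
      (Set.Ioc 0 T) := by
    refine ib.mono' (m3.sub_const _).aestronglyMeasurable ?_
    filter_upwards [ae_restrict_mem measurableSet_Ioc] with u hu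
    exact hpt u hu
  have hvol : (volume.restrict (Set.Ioc 0 T)).real Set.univ = T := by simp [measureReal_def, hT]
  have e2 : duhamel κ c (duhamel κ c fun _ _ => 1) T y - T * σ = ∫ u in Set.Ioc 0 T,
      (∫ z, c z * duhamel κ c (fun _ _ => 1) (T - u) z ∂(κ (u.toNNReal, y)) - σ) := by
    have i3 : IntegrableOn (fun u : ℝ =>
        ∫ z, c z * duhamel κ c (fun _ _ => 1) (T - u) z ∂(κ (u.toNNReal, y))) (Set.Ioc 0 T) := by
      exact (Integrable.add hdi (integrable_const σ)).congr (Eventually.of_forall fun u => by simp)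
    rw [integral_sub i3 (integrable_const _), integral_const, hvol, smul_eq_mul]
    rfl
  rw [e2]
  refine (abs_integral_le_of_abs_le ib ?_).trans ?_
  · filter_upwards [ae_restrict_mem measurableSet_Ioc] with u hu
    exact hpt u hu
  · rw [integral_add (i1.const_mul _) (i2.const_mul _), integral_const_mul, integral_const_mul, e1]
    have a1 := mul_le_mul_of_nonneg_left (setIntegral_Ioc_exp_neg_mul_le hα T)
      (show 0 ≤ C * (C * d / α) * (d + p) * v y + C * (C * d / α) * d * v y by positivity)
    rw [← add_mul]
    refine a1.trans (le_of_eq ?_)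
    field_simp
    ring

end HasErgodicBound

/-! ### Taylor expansion and derivatives of the Poisson weights. -/

theorem ContDiff.exists_abs_sub_taylor_three_le {f : ℝ → ℝ} (hf : ContDiff ℝ 4 f) (a B : ℝ) :
    ∃ K, ∀ h, |h| ≤ B → |f (a + h) - (f a + deriv f a * h + iteratedDeriv 2 f a / 2 * h ^ 2 +
      iteratedDeriv 3 f a / 6 * h ^ 3)| ≤ K * h ^ 4 := by
  have hc : Continuous (iteratedDeriv 4 f) := hf.continuous_iteratedDeriv 4 le_rfl
  obtain ⟨K, hK⟩ := (isCompact_Icc (a := a - B) (b := a + B)).exists_bound_of_continuousOn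
    hc.continuousOn
  refine ⟨K / 24, fun h hh => ?_⟩
  -- The Lagrange form of the remainder needs distinct endpoints.
  rcases eq_or_ne h 0 with rfl | h0
  · simp
  have hne : a ≠ a + h := by simpa using h0
  obtain ⟨x', hx', e⟩ := taylor_mean_remainder_lagrange_iteratedDeriv (n := 3) hne
    (f := f) (by norm_num; exact hf.contDiffOn)
  have hu : UniqueDiffOn ℝ (Set.uIcc a (a + h)) := uniqueDiffOn_uIcc hne
  have hd : ∀ n : ℕ, n ≤ 4 → iteratedDerivWithin n f (Set.uIcc a (a + h)) a = iteratedDeriv n f a :=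
    fun n hn => iteratedDerivWithin_eq_iteratedDeriv hu
      (hf.contDiffAt.of_le (by exact_mod_cast hn)) Set.left_mem_uIcc
  rw [taylor_within_apply] at e
  simp only [Finset.sum_range_succ, Finset.range_zero, Finset.sum_empty] at e
  rw [hd 0 (by norm_num), hd 1 (by norm_num), hd 2 (by norm_num), hd 3 (by norm_num)] at e
  simp only [iteratedDeriv_zero, iteratedDeriv_one, add_sub_cancel_left, smul_eq_mul,
    Nat.factorial] at e
  have e' : f (a + h) - (f a + deriv f a * h + iteratedDeriv 2 f a / 2 * h ^ 2 +
      iteratedDeriv 3 f a / 6 * h ^ 3) = iteratedDeriv 4 f x' * h ^ 4 / 24 := by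
    norm_num at e
    rw [← e]
    ring
  have hx : x' ∈ Set.Icc (a - B) (a + B) := by
    have h1 := abs_le.1 hh
    rw [Set.mem_Icc]
    rw [Set.uIoo, Set.mem_Ioo] at hx'
    constructor
    · refine le_trans ?_ hx'.1.le
      exact le_min (by linarith) (by linarith)
    · refine hx'.2.le.trans ?_
      exact max_le (by linarith) (by linarith)
  have hb := hK x' hx
  rw [Real.norm_eq_abs] at hb
  have h4 : 0 ≤ h ^ 4 := by positivity
  rw [e', abs_div, abs_mul, abs_of_nonneg h4, abs_of_pos (by norm_num : (0 : ℝ) < 24)]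
  have := mul_le_mul_of_nonneg_right hb h4
  linarith

/-- The Poisson probability of `k` as a function of the mean. -/
def poissonProb (k : ℕ) (y : ℝ) : ℝ :=
  Real.exp (-y) * y ^ k / (Nat.factorial k : ℝ)

theorem contDiff_poissonProb (k : ℕ) : ContDiff ℝ 4 (poissonProb k) := by
  unfold poissonProb
  fun_prop

theorem hasDerivAt_poissonProb (k : ℕ) (y : ℝ) :
    HasDerivAt (poissonProb k)
      (Real.exp (-y) * (k * y ^ (k - 1) - y ^ k) / (Nat.factorial k : ℝ)) y := by
  have h := (((hasDerivAt_neg y).exp).mul (hasDerivAt_pow k y)).div_const (Nat.factorial k : ℝ)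
  refine h.congr_deriv ?_
  simp
  ring

theorem deriv_poissonProb (k : ℕ) {a : ℝ} (ha : 0 < a) :
    deriv (poissonProb k) a = poissonProb k a * (k / a - 1) := by
  rw [(hasDerivAt_poissonProb k a).deriv, poissonProb]
  rcases k with _ | k
  · simp
  · simp only [Nat.add_sub_cancel]
    field_simp
    ring

theorem iteratedDeriv_two_poissonProb (k : ℕ) {a : ℝ} (ha : 0 < a) :
    iteratedDeriv 2 (poissonProb k) a =
      poissonProb k a * (1 - 2 * k / a + k * (k - 1) / a ^ 2) := by
  have e : deriv (poissonProb k) =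
      fun y => Real.exp (-y) * (k * y ^ (k - 1) - y ^ k) / (Nat.factorial k : ℝ) :=
    funext fun y => (hasDerivAt_poissonProb k y).deriv
  have h := (((hasDerivAt_neg a).exp).mul
    (((hasDerivAt_pow (k - 1) a).const_mul (k : ℝ)).sub (hasDerivAt_pow k a))).div_const
      (Nat.factorial k : ℝ)
  rw [iteratedDeriv_succ, iteratedDeriv_one, e]
  refine h.deriv.trans ?_
  rw [poissonProb]
  -- The exponents k − 1 and k − 2 are truncated subtractions, so k = 0 and k = 1 are treated apart;
  -- there the coefficients k and k(k − 1) vanish accordingly.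
  rcases k with _ | _ | k
  · simp
  · simp
    field_simp
    ring
  · simp
    field_simp
    ring

/-! ### Moment bounds and the expansion in ε. -/

/-- The first four moments of the occupation integral of a centered function. -/
theorem IsMarkovProcessFrom.exists_occupation_moment_bounds {S Ω : Type*} [MeasurableSpace S]
    [MeasurableSpace Ω] {κ : Kernel (ℝ≥0 × S) S} {x : S} {X : ℝ≥0 → Ω → S} {P : Measure Ω}
    [IsProbabilityMeasure P] (hX : IsMarkovProcessFrom κ x X P) {v : S → ℝ} {π : Measure S}
    {d α : ℝ} (hκ : HasErgodicBound κ v π d α) {c : S → ℝ} (hc : Measurable c) {C : ℝ}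
    (hC : ∀ y, |c y| ≤ C) (hc0 : ∫ y, c y ∂π = 0) :
    Tendsto (fun T => ∫ ω, occupation X c T ω ∂P) atTop (𝓝 (greenPotential κ c x)) ∧
    ∃ A, ∀ T, 0 ≤ T →
      |∫ ω, occupation X c T ω ^ 2 ∂P - T * (2 * ∫ y, c y * greenPotential κ c y ∂π)| ≤ A ∧
      |∫ ω, occupation X c T ω ^ 3 ∂P| ≤ A * T ∧
      |∫ ω, occupation X c T ω ^ 4 ∂P| ≤ A * T ^ 2 := by
  have := hX.transition.isMarkovKernel
  have hα := hκ.pos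
  have hd := hκ.nonneg
  have hp := hκ.integral_nonneg
  have hC0 : 0 ≤ C := (abs_nonneg _).trans (hC x)
  have hv := hκ.weight_pos
  have m0 : Measurable (Function.uncurry fun (_ : ℝ) (_ : S) => (1 : ℝ)) := measurable_const
  have m1 := measurable_duhamel (κ := κ) hc m0
  have m2 := measurable_duhamel (κ := κ) hc m1
  set L := C ^ 2 * d * (d + 2 * ∫ z, v z ∂π) / α with hL
  have hL0 : 0 ≤ L := by positivity
  -- Read as D²(D1): D1 is O(v) uniformly in time, and D² contributes one factor T.
  have b3 : ∀ T, 0 ≤ T → |(duhamel κ c)^[3] (fun _ _ => 1) T x| ≤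
      2 * (C * d / α) * (L * T) * v x := fun T hT =>
    hκ.abs_duhamel_duhamel_le hc hC hc0 m1 (K := 2 * (C * d / α)) (T := T) (by positivity)
      (fun R h0 _ y => hκ.abs_duhamel_one_le hc hC hc0 y h0) hT le_rfl x
  have b2 : ∀ T R, 0 ≤ R → R ≤ T → ∀ y, |duhamel κ c (duhamel κ c (fun _ _ => 1)) R y| ≤
      1 * (L * T) * v y := fun T R h0 hRT y =>
    hκ.abs_duhamel_duhamel_le hc hC hc0 m0 (K := 1) (T := T) (by positivity)
      (fun R _ _ y => by simpa using hκ.toIsGeometricallyErgodic.one_le y) h0 hRT y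
  -- Read as D²(D²1): each square contributes one factor T.
  have b4 : ∀ T, 0 ≤ T → |(duhamel κ c)^[4] (fun _ _ => 1) T x| ≤
      1 * (L * T) * (L * T) * v x := fun T hT =>
    hκ.abs_duhamel_duhamel_le hc hC hc0 m2 (K := 1 * (L * T)) (T := T) (by positivity)
      (b2 T) hT le_rfl x
  have hmom := fun (n : ℕ) T (hT : 0 ≤ T) => hX.integral_occupation_pow hc hC hT n
  refine ⟨?_, ?_⟩
  · refine (hκ.tendsto_duhamel_one hc hC hc0 x).congr' ?_
    filter_upwards [eventually_ge_atTop 0] with T hT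
    have := hmom 0 T hT
    simpa using this.symm
  set A2 := C ^ 2 * d / α * (2 * d + ∫ z, v z ∂π) * v x / α with hA2
  have hvx := hv x
  have hA20 : 0 ≤ A2 := by positivity
  refine ⟨2 * A2 + 6 * (2 * (C * d / α) * L * v x) + 24 * (L ^ 2 * v x), fun T hT => ?_⟩
  have n1 : 0 ≤ 6 * (2 * (C * d / α) * L * v x) := by positivity
  have n2 : 0 ≤ 24 * (L ^ 2 * v x) := by positivity
  refine ⟨?_, ?_, ?_⟩
  · have h1 : |duhamel κ c (duhamel κ c fun _ _ => 1) T x -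
        T * ∫ z, c z * greenPotential κ c z ∂π| ≤ A2 :=
      hκ.abs_duhamel_duhamel_one_sub_le hc hC hc0 x hT
    have h2 : ∫ ω, occupation X c T ω ^ 2 ∂P = 2 * duhamel κ c (duhamel κ c fun _ _ => 1) T x := by
      simpa [Nat.factorial] using hmom 1 T hT
    rw [h2, mul_left_comm, ← mul_sub, abs_mul, abs_two]
    linarith
  · have h2 : ∫ ω, occupation X c T ω ^ 3 ∂P = 6 * (duhamel κ c)^[3] (fun _ _ => 1) T x := by
      have := hmom 2 T hT
      norm_num [Nat.factorial] at this
      simpa using this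
    rw [h2, abs_mul, abs_of_pos (by norm_num : (0 : ℝ) < 6)]
    have := b3 T hT
    calc 6 * |(duhamel κ c)^[3] (fun _ _ => 1) T x|
        ≤ 6 * (2 * (C * d / α) * (L * T) * v x) := by linarith
      _ = 6 * (2 * (C * d / α) * L * v x) * T := by ring
      _ ≤ _ := mul_le_mul_of_nonneg_right (by linarith) hT
  · have h2 : ∫ ω, occupation X c T ω ^ 4 ∂P = 24 * (duhamel κ c)^[4] (fun _ _ => 1) T x := by
      have := hmom 3 T hT
      norm_num [Nat.factorial] at this
      simpa using this
    rw [h2, abs_mul, abs_of_pos (by norm_num : (0 : ℝ) < 24)]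
    have := b4 T hT
    calc 24 * |(duhamel κ c)^[4] (fun _ _ => 1) T x|
        ≤ 24 * (1 * (L * T) * (L * T) * v x) := by linarith
      _ = 24 * (L ^ 2 * v x) * T ^ 2 := by ring
      _ ≤ _ := mul_le_mul_of_nonneg_right (by linarith) (by positivity)

/-- The expansion of the expectation of a smooth function of a small multiple of the occupation
integral over a long time. -/
theorem IsMarkovProcessFrom.isLittleO_integral_comp_occupation {S Ω : Type*} [MeasurableSpace S]
    [MeasurableSpace Ω] {κ : Kernel (ℝ≥0 × S) S} {x : S} {X : ℝ≥0 → Ω → S} {P : Measure Ω}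
    [IsProbabilityMeasure P] (hX : IsMarkovProcessFrom κ x X P) {v : S → ℝ} {π : Measure S}
    {d α : ℝ} (hκ : HasErgodicBound κ v π d α) {c : S → ℝ} (hc : Measurable c) {C : ℝ}
    (hC : ∀ y, |c y| ≤ C) (hc0 : ∫ y, c y ∂π = 0) {φ : ℝ → ℝ} (hφ : ContDiff ℝ 4 φ) (a : ℝ)
    {t : ℝ} (ht : 0 < t) :
    (fun ε : ℝ => ∫ ω, φ (a + ε * occupation X c (t / ε) ω) ∂P -
      (φ a + ε * (deriv φ a * greenPotential κ c x +
        1 / 2 * iteratedDeriv 2 φ a * (2 * (∫ y, c y * greenPotential κ c y ∂π) * t))))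
      =o[𝓝[>] 0] fun ε => ε := by
  obtain ⟨htend, A, hA⟩ := hX.exists_occupation_moment_bounds hκ hc hC hc0
  -- The increment ε Z_{t/ε} is at most C t in absolute value for every ε, so one remainder constant
  -- serves them all.
  obtain ⟨K, hK⟩ := hφ.exists_abs_sub_taylor_three_le a (C * t)
  set G := greenPotential κ c x
  set σ := 2 * ∫ y, c y * greenPotential κ c y ∂π with hσ
  set φ₁ := deriv φ a
  set φ₂ := iteratedDeriv 2 φ a / 2 with hφ₂
  set φ₃ := iteratedDeriv 3 φ a / 6
  have hA0 : 0 ≤ A := (abs_nonneg _).trans (hA 0 le_rfl).1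
  have hT : Tendsto (fun ε : ℝ => t / ε) (𝓝[>] 0) atTop :=
    (tendsto_inv_nhdsGT_zero.const_mul_atTop ht)
  -- The total error divided by ε: remainder, second-order and third-order terms are each O(ε), and
  -- the last summand is the first-moment error.
  set η : ℝ → ℝ := fun ε => ε * (|K| * A * t ^ 2 + |φ₂| * A + |φ₃| * A * t) +
    |φ₁| * |∫ ω, occupation X c (t / ε) ω ∂P - G| with hη
  have hη0 : Tendsto η (𝓝[>] 0) (𝓝 0) := by
    have h1 : Tendsto (fun ε : ℝ => ε) (𝓝[>] 0) (𝓝 0) := tendsto_id.mono_left nhdsWithin_le_nhds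
    have h2 : Tendsto (fun ε => |∫ ω, occupation X c (t / ε) ω ∂P - G|) (𝓝[>] 0) (𝓝 0) := by
      have := ((htend.comp hT).sub_const G).abs
      simpa using this
    simpa using (h1.mul_const (|K| * A * t ^ 2 + |φ₂| * A + |φ₃| * A * t)).add (h2.const_mul |φ₁|)
  have key : ∀ ε : ℝ, 0 < ε → |∫ ω, φ (a + ε * occupation X c (t / ε) ω) ∂P -
      (φ a + ε * (φ₁ * G + φ₂ * (σ * t)))| ≤ ε * η ε := by
    intro ε hε
    set T := t / ε with hTdef
    have hT0 : 0 ≤ T := by positivity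
    have hεT : ε * T = t := by rw [hTdef]; field_simp
    have hZm : Measurable (occupation X c T) := (hX.measurable_occupation hc).of_uncurry_left
    have hZb : ∀ ω, |occupation X c T ω| ≤ C * T := abs_occupation_le hC hT0 le_rfl
    have hZi : ∀ n : ℕ, Integrable (fun ω => occupation X c T ω ^ n) P := fun n =>
      Integrable.of_bound (hZm.pow_const n).aestronglyMeasurable ((C * T) ^ n)
        (Eventually.of_forall fun ω => by
          rw [norm_pow]; exact pow_le_pow_left₀ (norm_nonneg _) (hZb ω) n)
    have hZi1 : Integrable (occupation X c T) P := by simpa using hZi 1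
    have hpi : Integrable (fun ω => φ a + φ₁ * (ε * occupation X c T ω) +
        φ₂ * (ε * occupation X c T ω) ^ 2 + φ₃ * (ε * occupation X c T ω) ^ 3) P := by
      simp_rw [mul_pow]
      exact (((integrable_const _).add ((hZi1.const_mul _).const_mul _)).add
        (((hZi 2).const_mul _).const_mul _)).add (((hZi 3).const_mul _).const_mul _)
    have hpe : ∫ ω, (φ a + φ₁ * (ε * occupation X c T ω) +
        φ₂ * (ε * occupation X c T ω) ^ 2 + φ₃ * (ε * occupation X c T ω) ^ 3) ∂P =
        φ a + φ₁ * (ε * ∫ ω, occupation X c T ω ∂P) +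
          φ₂ * (ε ^ 2 * ∫ ω, occupation X c T ω ^ 2 ∂P) +
          φ₃ * (ε ^ 3 * ∫ ω, occupation X c T ω ^ 3 ∂P) := by
      simp_rw [mul_pow]
      have i1 : Integrable (fun ω => φ₁ * (ε * occupation X c T ω)) P :=
        (hZi1.const_mul _).const_mul _
      have i2 : Integrable (fun ω => φ₂ * (ε ^ 2 * occupation X c T ω ^ 2)) P :=
        ((hZi 2).const_mul _).const_mul _
      have i3 : Integrable (fun ω => φ₃ * (ε ^ 3 * occupation X c T ω ^ 3)) P :=
        ((hZi 3).const_mul _).const_mul _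
      have i0 : Integrable (fun _ : Ω => φ a) P := integrable_const _
      have i01 : Integrable (fun ω => φ a + φ₁ * (ε * occupation X c T ω)) P := i0.add i1
      have i02 : Integrable (fun ω => φ a + φ₁ * (ε * occupation X c T ω) +
          φ₂ * (ε ^ 2 * occupation X c T ω ^ 2)) P := i01.add i2
      rw [integral_add i02 i3, integral_add i01 i2, integral_add i0 i1]
      simp only [integral_const_mul, integral_const, probReal_univ, one_smul]
    have hφm : Measurable fun ω => φ (a + ε * occupation X c T ω) :=
      hφ.continuous.measurable.comp ((hZm.const_mul ε).const_add a)
    have hrem : ∀ ω, |φ (a + ε * occupation X c T ω) - (φ a + φ₁ * (ε * occupation X c T ω) +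
        φ₂ * (ε * occupation X c T ω) ^ 2 + φ₃ * (ε * occupation X c T ω) ^ 3)| ≤
        |K| * ε ^ 4 * occupation X c T ω ^ 4 := fun ω => by
      have hb : |ε * occupation X c T ω| ≤ C * t := by
        rw [abs_mul, abs_of_pos hε, ← hεT, mul_left_comm]
        exact mul_le_mul_of_nonneg_left (hZb ω) hε.le
      refine (hK _ hb).trans ?_
      rw [mul_pow, mul_assoc]
      exact mul_le_mul_of_nonneg_right (le_abs_self K) (by positivity)
    have hri : Integrable (fun ω => |K| * ε ^ 4 * occupation X c T ω ^ 4) P := (hZi 4).const_mul _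
    have hφi : Integrable (fun ω => φ (a + ε * occupation X c T ω)) P := by
      have : Integrable (fun ω => φ (a + ε * occupation X c T ω) -
          (φ a + φ₁ * (ε * occupation X c T ω) + φ₂ * (ε * occupation X c T ω) ^ 2 +
            φ₃ * (ε * occupation X c T ω) ^ 3)) P :=
        hri.mono' (hφm.aestronglyMeasurable.sub hpi.aestronglyMeasurable)
          (Eventually.of_forall hrem)
      exact (this.add hpi).congr (Eventually.of_forall fun ω => by simp)
    have hmain := abs_integral_le_of_abs_le hri (Eventually.of_forall hrem)
    rw [integral_sub hφi hpi, hpe, integral_const_mul] at hmain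
    obtain ⟨h2, h3, h4⟩ := hA T hT0
    set E := ∫ ω, φ (a + ε * occupation X c T ω) ∂P
    set M1 := ∫ ω, occupation X c T ω ∂P
    set M2 := ∫ ω, occupation X c T ω ^ 2 ∂P
    set M3 := ∫ ω, occupation X c T ω ^ 3 ∂P
    set M4 := ∫ ω, occupation X c T ω ^ 4 ∂P
    have split : E - (φ a + ε * (φ₁ * G + φ₂ * (σ * t))) =
        (E - (φ a + φ₁ * (ε * M1) + φ₂ * (ε ^ 2 * M2) + φ₃ * (ε ^ 3 * M3))) +
          (ε * φ₁ * (M1 - G) + ε ^ 2 * φ₂ * (M2 - T * σ) + ε ^ 3 * φ₃ * M3) := by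
      rw [← hεT]; ring
    have b1 : |ε * φ₁ * (M1 - G)| = ε * (|φ₁| * |M1 - G|) := by
      rw [abs_mul, abs_mul, abs_of_pos hε, mul_assoc]
    have b2 : |ε ^ 2 * φ₂ * (M2 - T * σ)| ≤ ε * (ε * (|φ₂| * A)) := by
      rw [abs_mul, abs_mul, abs_of_pos (by positivity : 0 < ε ^ 2)]
      calc ε ^ 2 * |φ₂| * |M2 - T * σ| ≤ ε ^ 2 * |φ₂| * A := by gcongr
        _ = _ := by ring
    have b3 : |ε ^ 3 * φ₃ * M3| ≤ ε * (ε * (|φ₃| * A * t)) := by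
      rw [abs_mul, abs_mul, abs_of_pos (by positivity : 0 < ε ^ 3)]
      calc ε ^ 3 * |φ₃| * |M3| ≤ ε ^ 3 * |φ₃| * (A * T) := by gcongr
        _ = _ := by rw [← hεT]; ring
    have b4 : |K| * ε ^ 4 * M4 ≤ ε * (ε * (|K| * A * t ^ 2)) := by
      calc |K| * ε ^ 4 * M4 ≤ |K| * ε ^ 4 * (A * T ^ 2) := by
            gcongr; exact (le_abs_self _).trans h4
        _ = _ := by rw [← hεT]; ring
    have t1 := abs_add_three (ε * φ₁ * (M1 - G)) (ε ^ 2 * φ₂ * (M2 - T * σ)) (ε ^ 3 * φ₃ * M3)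
    rw [split]
    refine (abs_add_le _ _).trans ?_
    have e : ε * η ε = ε * (ε * (|K| * A * t ^ 2)) + (ε * (|φ₁| * |M1 - G|) +
        ε * (ε * (|φ₂| * A)) + ε * (ε * (|φ₃| * A * t))) := by
      simp only [hη]
      ring
    rw [e]
    linarith
  have hlo : (fun ε => ε * η ε) =o[𝓝[>] 0] fun ε : ℝ => ε := by
    simpa using (Asymptotics.isBigO_refl (fun ε : ℝ => ε) (𝓝[>] 0)).mul_isLittleO
      ((Asymptotics.isLittleO_one_iff ℝ).2 hη0)
  refine Asymptotics.IsBigO.trans_isLittleO (Asymptotics.IsBigO.of_bound 1 ?_) hlo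
  filter_upwards [self_mem_nhdsWithin] with ε hε
  have h := key ε hε
  rw [one_mul, Real.norm_eq_abs, Real.norm_eq_abs]
  refine le_trans (le_of_eq ?_) (h.trans (le_abs_self _))
  congr 3
  rw [hφ₂, hσ]
  ring

/-! ### Laws of the counting processes and the change of time scale. -/

/-- Take expectations in the conditional law of the single increment over (0, t], using that the
process starts at 0 almost surely. -/
theorem IsDoublyStochasticPoisson.real_eq_integral {Ω : Type*} [MeasurableSpace Ω]
    {P : Measure Ω} [IsProbabilityMeasure P] {lam : ℝ≥0 → Ω → ℝ} {N : ℝ≥0 → Ω → ℕ}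
    (hN : IsDoublyStochasticPoisson lam N P) (t : ℝ≥0) (k : ℕ) :
    P.real {ω | N t ω = k} = ∫ ω, poissonProb k (integratedIntensity lam 0 t ω) ∂P := by
  have hm : ⨆ t, MeasurableSpace.comap (lam t) inferInstance ≤ ‹MeasurableSpace Ω› :=
    iSup_le fun s => (hN.intensity_measurable.of_uncurry_left (x := s)).comap_le
  have h := hN.conditional_law 1 ![0, t]
    (Fin.monotone_iff_le_succ.2 fun i => by fin_cases i; simp) fun _ => k
  have hs : {ω | ∀ i : Fin 1, N ((![0, t] : Fin 2 → ℝ≥0) i.succ) ω =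
      N ((![0, t] : Fin 2 → ℝ≥0) i.castSucc) ω + k} = {ω | N t ω = N 0 ω + k} := by
    ext ω
    simp [Fin.forall_fin_one]
  rw [hs] at h
  have hmeas : MeasurableSet {ω | N t ω = N 0 ω + k} :=
    measurableSet_eq_fun (hN.counting.measurable t) ((hN.counting.measurable 0).add_const k)
  have e := integral_condExp hm (f := {ω | N t ω = N 0 ω + k}.indicator fun _ => (1 : ℝ)) (μ := P)
  rw [integral_congr_ae h, integral_indicator_const _ hmeas, smul_eq_mul, mul_one] at e
  have e2 : P.real {ω | N t ω = k} = P.real {ω | N t ω = N 0 ω + k} := by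
    refine measureReal_congr ?_
    filter_upwards [hN.counting.zero] with ω hω
    refine propext ?_
    change N t ω = k ↔ N t ω = N 0 ω + k
    rw [hω, zero_add]
  rw [e2, ← e]
  simp [poissonProb]

theorem IsPoissonProcess.real_eq {Ω : Type*} [MeasurableSpace Ω] {P : Measure Ω}
    {r : ℝ≥0} {N : ℝ≥0 → Ω → ℕ} (hN : IsPoissonProcess r N P) (t : ℝ≥0) (k : ℕ) :
    P.real {ω | N t ω = k} = poissonProb k (r * t) := by
  have h := hN.law 0 t zero_le
  have h1 : P.map (fun ω => N t ω - N 0 ω) = P.map (N t) := by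
    refine Measure.map_congr ?_
    filter_upwards [hN.counting.zero] with ω hω
    simp [hω]
  rw [h1, tsub_zero] at h
  have h2 : P.real {ω | N t ω = k} = (P.map (N t)).real {k} := by
    rw [map_measureReal_apply (hN.counting.measurable t) (measurableSet_singleton k)]
    rfl
  rw [h2, h, poissonMeasure_real_singleton, poissonProb]
  push_cast
  rfl

/-- The substitution u = εs turns fast modulation over [0, t] into a long-time integral over [0,
t/ε]; subtracting the mean isolates the fluctuation. -/
theorem integratedIntensity_comp_div {S Ω : Type*} [MeasurableSpace S] [MeasurableSpace Ω]
    {X : ℝ≥0 → Ω → S} (hX : Measurable (Function.uncurry X)) {f : S → ℝ} (hf : Measurable f)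
    {B : ℝ} (hB : ∀ y, |f y| ≤ B) (π : Measure S) {ε : ℝ≥0} (hε : 0 < ε) (t : ℝ≥0) (ω : Ω) :
    integratedIntensity (fun t ω => f (X (t / ε) ω)) 0 t ω =
      (∫ y, f y ∂π) * t + ε * occupation X (centered π f) (t / ε) ω := by
  have hε' : (0 : ℝ) < ε := hε
  have h1 : integratedIntensity (fun t ω => f (X (t / ε) ω)) 0 t ω =
      ∫ u in (0 : ℝ)..t, (fun s : ℝ => f (X s.toNNReal ω)) (u / ε) := by
    unfold integratedIntensity
    refine intervalIntegral.integral_congr fun u hu => ?_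
    simp only
    rw [Real.toNNReal_div' hε'.le, Real.toNNReal_coe]
  have hT : (0 : ℝ) ≤ t / ε := by positivity
  have hXm : Measurable fun s : ℝ => X s.toNNReal ω :=
    hX.comp (f := fun s : ℝ => (s.toNNReal, ω)) (by fun_prop)
  have hi : IntegrableOn (fun s : ℝ => f (X s.toNNReal ω)) (Set.Ioc 0 (t / ε)) :=
    Measure.integrableOn_of_bounded (by simp) (hf.comp hXm).aestronglyMeasurable
      (Eventually.of_forall fun s => hB _)
  rw [h1, intervalIntegral.integral_comp_div (fun s : ℝ => f (X s.toNNReal ω)) hε'.ne', zero_div,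
    intervalIntegral.integral_of_le hT]
  unfold occupation centered
  rw [integral_sub hi (integrable_const _), integral_const]
  have hvol : (volume.restrict (Set.Ioc 0 ((t : ℝ) / ε))).real Set.univ = t / ε := by
    simp [measureReal_def, hT]
  rw [hvol, smul_eq_mul, smul_eq_mul]
  field_simp
  ring

end

/-! ### The expansion of the Poisson probabilities. -/

theorem theorem3
    {S : Type*} [TopologicalSpace S] [PolishSpace S] [MeasurableSpace S] [BorelSpace S]
    {Ω : Type*} [MeasurableSpace Ω] (P : Measure Ω) [IsProbabilityMeasure P]
    {Ω₀ : Type*} [MeasurableSpace Ω₀] (P₀ : Measure Ω₀) [IsProbabilityMeasure P₀]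
    (κ : Kernel (ℝ≥0 × S) S) (x : S) (X : ℝ≥0 → Ω → S)
    (hX : IsMarkovProcessFrom κ x X P)
    (v : S → ℝ) (π : Measure S) (hκ : IsGeometricallyErgodic κ v π)
    (f : S → ℝ) (hf_meas : Measurable f) (hf_nonneg : ∀ y, 0 ≤ f y)
    (hf_bdd : ∃ C : ℝ, ∀ y, f y ≤ C)
    (hf_pos : 0 < ∫ y, f y ∂π)
    (N : ℝ≥0 → ℝ≥0 → Ω → ℕ)
    (hN : ∀ ε : ℝ≥0, 0 < ε → ε ≤ 1 →
      IsDoublyStochasticPoisson (fun t ω => f (X (t / ε) ω)) (N ε) P)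
    (N₀ : ℝ≥0 → Ω₀ → ℕ)
    (hN₀ : IsPoissonProcess (∫ y, f y ∂π).toNNReal N₀ P₀)
    (t : ℝ≥0) (ht : 0 < t) (k : ℕ) :
    (∀ y, IntegrableOn (fun s : ℝ => meanCentered κ π f y s.toNNReal) (Set.Ioi 0)) ∧
    Integrable (fun y => centered π f y * potential κ π f y) π ∧
    (fun ε : ℝ≥0 =>
        P.real {ω | N ε t ω = k} -
          (P₀.real {ω | N₀ t ω = k} +
            (ε : ℝ) * P₀.real {ω | N₀ t ω = k} *
              (((k : ℝ) / ((∫ y, f y ∂π) * t) - 1) * potential κ π f x +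
                1 / 2 * (1 - 2 * (k : ℝ) / ((∫ y, f y ∂π) * t) +
                    (k : ℝ) * ((k : ℝ) - 1) / ((∫ y, f y ∂π) * t) ^ 2) *
                  (asymptoticVariance κ π f * t))))
      =o[𝓝[>] (0 : ℝ≥0)] (fun ε : ℝ≥0 => (ε : ℝ)) := by
  have := hX.transition.isMarkovKernel
  have := hκ.isProbabilityMeasure
  obtain ⟨d, α, hE⟩ := hκ.exists_hasErgodicBound
  obtain ⟨B, hB⟩ := hf_bdd
  have hfB : ∀ y, |f y| ≤ B := fun y => (abs_of_nonneg (hf_nonneg y)).trans_le (hB y)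
  have hfi : Integrable f π :=
    Integrable.of_bound hf_meas.aestronglyMeasurable B (Eventually.of_forall hfB)
  have hc : Measurable (centered π f) := hf_meas.sub_const _
  have hC : ∀ y, |centered π f y| ≤ B + B := fun y =>
    (abs_sub _ _).trans (add_le_add (hfB y) (abs_kernel_integral_le hfB))
  have hc0 : ∫ y, centered π f y ∂π = 0 := by
    unfold centered
    rw [integral_sub hfi (integrable_const _)]
    simp
  -- `potential κ π f` is by definition `greenPotential` of the centered function, so both
  -- integrability claims hold up to unfolding.
  refine ⟨hE.integrableOn_kernel_integral hc hC hc0, hE.integrable_mul_greenPotential hc hC hc0, ?_⟩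
  set a : ℝ := (∫ y, f y ∂π) * t with ha
  have ha0 : 0 < a := mul_pos hf_pos ht
  have hP₀ : P₀.real {ω | N₀ t ω = k} = poissonProb k a := by
    rw [hN₀.real_eq, Real.coe_toNNReal _ hf_pos.le]
  have hmain := hX.isLittleO_integral_comp_occupation hE hc hC hc0 (contDiff_poissonProb k) a
    (t := t) ht
  have hcoe : Tendsto (fun ε : ℝ≥0 => (ε : ℝ)) (𝓝[>] 0) (𝓝[>] 0) := by
    refine tendsto_nhdsWithin_iff.2 ⟨?_, ?_⟩
    · exact (NNReal.continuous_coe.tendsto' 0 0 rfl).mono_left nhdsWithin_le_nhds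
    · filter_upwards [self_mem_nhdsWithin] with ε hε
      exact hε
  refine (hmain.comp_tendsto hcoe).congr' ?_ (Eventually.of_forall fun ε => rfl)
  -- The Cox processes are given only for ε ≤ 1, which holds eventually.
  have hle : ∀ᶠ ε : ℝ≥0 in 𝓝[>] 0, ε ≤ 1 :=
    nhdsWithin_le_nhds (Iic_mem_nhds one_pos)
  filter_upwards [self_mem_nhdsWithin, hle] with ε hε hε1
  have hε0 : 0 < ε := hε
  rw [(hN ε hε0 hε1).real_eq_integral, hP₀]
  simp_rw [integratedIntensity_comp_div hX.measurable hf_meas hfB π hε0 t]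
  simp only [Function.comp_apply]
  rw [deriv_poissonProb k ha0, iteratedDeriv_two_poissonProb k ha0]
  have hg : greenPotential κ (centered π f) = potential κ π f := rfl
  rw [hg, asymptoticVariance]
  ring
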